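/- Identify $\mathbb R^2$ with $\mathbb C$. A domain is a non-empty open connected subset of $\mathbb R^2$. Distances, diameters and lengths $\ell$ are Euclidean, and the distance to the empty set is $\infty$. For a domain $\Omega$ and $a,b\in\Omega$, let $\lambda_\Omega(a,b)$ be the infimum of the lengths of the curves in $\Omega$ from $a$ to $b$. For $A\ge 1$, a domain $\Omega\subset\mathbb R^2$ is called inner $A$-uniform if for every $a,b\in\Omega$ there is a curve $\gamma\colon[0,1]\to\Omega$ with $\gamma(0)=a$, $\gamma(1)=b$, $$\ell(\gamma)\le A\,\lambda_\Omega(a,b)\quad\text{and}\quad \min\{\ell(\gamma|_{[0,t]}),\ell(\gamma|_{[t,1]})\}\le A\,\operatorname{dist}(\gamma(t),\partial\Omega)\ \text{ for all } t\in[0,1].$$ A domain is finitely connected if its complement in $\mathbb R^2$ has finitely many connected components. Theorem. For every $A\ge 1$ there is a constant $C=C(A)\ge 1$, depending only on $A$, such that the following hold for every inner $A$-uniform domain $\Omega\subset\mathbb R^2$. (1) For every $\delta>0$, let $D\subset\mathbb R^2$ be the set whose complement $\mathbb R^2\setminus D$ is the union of those components $S$ of $\mathbb R^2\setminus\Omega$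 with $\operatorname{diam}S>\delta$ (unbounded components included). Then $D$ is a domain and $D$ is inner $C$-uniform. (2) If $\Omega$ is bounded or contains the exterior of a disk, then there is a sequence of finitely connected inner $C$-uniform domains $\Omega_n$, $n\in\mathbb N$, such that (i) $\Omega\subset\Omega_{n+1}\subset\Omega_n$ for each $n\in\mathbb N$; (ii) each component of $\mathbb R^2\setminus\Omega$ with more than one point is a component of $\mathbb R^2\setminus\Omega_n$ for all sufficiently large $n$; (iii) the set $\left(\bigcap_{n}\Omega_n\right)\setminus\Omega$ is totally disconnected. -/

import Mathlib

open Set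
open scoped ENNReal

namespace InnerUniform

/-- A planar domain: a non-empty, open, connected subset of the plane `ℂ = ℝ²`. -/
structure IsPlanarDomain (Ω : Set ℂ) : Prop where
  isOpen : IsOpen Ω
  isConnected : IsConnected Ω

/-- `γ : [0,1] → Ω` is a curve in `Ω` from `a` to `b`; only the values of `γ` on `[0,1]` matter. -/
structure IsCurveIn (Ω : Set ℂ) (a b : ℂ) (γ : ℝ → ℂ) : Prop where
  continuousOn : ContinuousOn γ (Icc 0 1)
  mapsTo : MapsTo γ (Icc 0 1) Ω
  source : γ 0 = a
  target : γ 1 = b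

/-- The Euclidean length (possibly infinite) of the subcurve `γ|_{[s,t]}`. -/
noncomputable def curveLength (γ : ℝ → ℂ) (s t : ℝ) : ℝ≥0∞ :=
  eVariationOn γ (Icc s t)

/-- The inner metric `λ_Ω(a,b)`: the infimum of the lengths of the curves in `Ω` from `a` to `b`. -/
noncomputable def innerDist (Ω : Set ℂ) (a b : ℂ) : ℝ≥0∞ :=
  ⨅ (γ : ℝ → ℂ) (_ : IsCurveIn Ω a b γ), curveLength γ 0 1

/-- `γ` is an inner `A`-uniform curve from `a` to `b` with respect to `Ω`:
`ℓ(γ) ≤ A λ_Ω(a,b)`, and `min {ℓ(γ|_{[0,t]}), ℓ(γ|_{[t,1]})} ≤ A dist(γ(t), ∂Ω)` for `t ∈ [0,1]`.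
The distance to an empty boundary is `∞`. -/
structure IsInnerUniformCurve (A : ℝ) (Ω : Set ℂ) (a b : ℂ) (γ : ℝ → ℂ) : Prop where
  isCurveIn : IsCurveIn Ω a b γ
  length_le : curveLength γ 0 1 ≤ ENNReal.ofReal A * innerDist Ω a b
  cigar : ∀ t ∈ Icc (0 : ℝ) 1,
    min (curveLength γ 0 t) (curveLength γ t 1) ≤
      ENNReal.ofReal A * Metric.infEDist (γ t) (frontier Ω)

/-- `Ω` is an inner `A`-uniform domain in the plane. -/
structure IsInnerUniformDomain (A : ℝ) (Ω : Set ℂ) : Prop where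
  isPlanarDomain : IsPlanarDomain Ω
  exists_curve : ∀ a ∈ Ω, ∀ b ∈ Ω, ∃ γ : ℝ → ℂ, IsInnerUniformCurve A Ω a b γ

/-- `S` is a connected component of the complement `ℂ \ Ω`. -/
def IsComplComponent (Ω S : Set ℂ) : Prop :=
  ∃ x ∈ Ωᶜ, S = connectedComponentIn Ωᶜ x

/-- `Ω` is finitely connected: `ℂ \ Ω` has finitely many components. -/
def IsFinitelyConnected (Ω : Set ℂ) : Prop :=
  {S : Set ℂ | IsComplComponent Ω S}.Finite

/-- `Ω` contains the exterior of some disk. -/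
def ContainsNhdInfty (Ω : Set ℂ) : Prop :=
  ∃ (c : ℂ) (R : ℝ), (Metric.closedBall c R)ᶜ ⊆ Ω

end InnerUniform

namespace InnerUniform

open Filter Topology Metric

/-! ### Curves and their lengths -/

/-! Both parts rest on one geometric fact, `exists_relativelySeparated`: two distinct components of
the complement that both reach out to distance ρ from chosen points s and t satisfy |s - t| ≥ cρ,
with c depending only on A. Together with `exists_innerDistBounded` (points connected in Ω inside a
disk of radius R have inner distance at most NR), it controls the domain D obtained by filling in
small components.

The planar topology is carried by continuous logarithms of (z - a)/(z - b). Such a logarithm exists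
on a set missed by a connected set that contains a and b, and cutting and pasting logarithms must
never produce a nonvanishing function on the plane that equals z - p near infinity
(`not_exists_continuous_extension`). This gives a Janiszewski theorem (`not_separated_of_disjoint`).
It also gives the separation: if s and t were too close, uniform curves would run around s where |z
- s| > |s - t|, and local logarithms of (z - s)/(z - t) in Ω would fit the principal one outside a
disk, although a compact piece of the complement around s is split off from one around t.

By separation, a filled component is at most comparable to its distance from the complement of D
(`IsFilling.mul_dist_le`). Hence each point of D reaches Ω by a short curve far from the boundary of
D (`exists_access`), and a connection in D on a scale not below the distance to the complement can
be replaced by one in Ω on a comparable scale (`IsFilling.innerDist_le`). For a, b in D, either a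
segment suffices, or an inner uniform curve of Ω is extended by access curves at both ends
(`cigar_concat`).

For the exhaustion, components of diameter at most 1/(n+1) are filled. Separation on the compact
boundary leaves finitely many others, and only one-point components are filled for every n. -/

/-- The concatenation of two curves parametrized by `[0,1]`. -/
noncomputable def concat (γ₁ γ₂ : ℝ → ℂ) (t : ℝ) : ℂ :=
  if t ≤ 1 / 2 then γ₁ (2 * t) else γ₂ (2 * t - 1)

/-- The reversed curve. -/
def rev (γ : ℝ → ℂ) (t : ℝ) : ℂ := γ (1 - t)

theorem curveLength_add (γ : ℝ → ℂ) {s t u : ℝ} (hst : s ≤ t) (htu : t ≤ u) :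
    curveLength γ s t + curveLength γ t u = curveLength γ s u := by
  simpa [curveLength] using eVariationOn.Icc_add_Icc γ (s := univ) hst htu (mem_univ t)

theorem curveLength_mono (γ : ℝ → ℂ) {s t s' t' : ℝ} (hs : s' ≤ s) (ht : t ≤ t') :
    curveLength γ s t ≤ curveLength γ s' t' :=
  eVariationOn.mono γ (Icc_subset_Icc hs ht)

theorem edist_le_curveLength (γ : ℝ → ℂ) {s t : ℝ} (hst : s ≤ t) :
    edist (γ s) (γ t) ≤ curveLength γ s t :=
  eVariationOn.edist_le γ (left_mem_Icc.2 hst) (right_mem_Icc.2 hst)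

theorem curveLength_affine (γ : ℝ → ℂ) {c d : ℝ} (hc : 0 < c) (s t : ℝ) :
    curveLength (fun x => γ (c * x + d)) s t = curveLength γ (c * s + d) (c * t + d) := by
  have h := eVariationOn.comp_eq_of_monotoneOn γ (t := Icc s t) (fun x => c * x + d)
    (fun x _ y _ hxy => by dsimp only; gcongr)
  rw [image_affine_Icc' hc] at h
  exact h

theorem curveLength_rev (γ : ℝ → ℂ) (s t : ℝ) :
    curveLength (rev γ) s t = curveLength γ (1 - t) (1 - s) := by
  have h := eVariationOn.comp_eq_of_antitoneOn γ (t := Icc s t) (fun x => 1 - x)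
    (fun x _ y _ hxy => by dsimp only; linarith)
  rw [image_const_sub_Icc] at h
  exact h

theorem curveLength_concat_left (γ₁ γ₂ : ℝ → ℂ) {s t : ℝ} (ht : t ≤ 1 / 2) :
    curveLength (concat γ₁ γ₂) s t = curveLength γ₁ (2 * s) (2 * t) := by
  have h := curveLength_affine γ₁ (c := 2) (d := 0) two_pos s t
  simp only [add_zero] at h
  rw [← h]
  refine eVariationOn.congr fun x hx => ?_
  simp only [concat, if_pos (hx.2.trans ht)]

theorem curveLength_concat_right {γ₁ γ₂ : ℝ → ℂ} (h12 : γ₁ 1 = γ₂ 0) {s t : ℝ}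
    (hs : 1 / 2 ≤ s) :
    curveLength (concat γ₁ γ₂) s t = curveLength γ₂ (2 * s - 1) (2 * t - 1) := by
  have h := curveLength_affine γ₂ (c := 2) (d := -1) two_pos s t
  simp only [← sub_eq_add_neg] at h
  rw [← h]
  refine eVariationOn.congr fun x hx => ?_
  rcases eq_or_lt_of_le (hs.trans hx.1) with rfl | hlt
  · simp [concat, h12]
  · simp only [concat, if_neg (not_le.2 hlt)]

theorem curveLength_concat_zero {γ₁ γ₂ : ℝ → ℂ} (h12 : γ₁ 1 = γ₂ 0) {t : ℝ}
    (ht : 1 / 2 ≤ t) :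
    curveLength (concat γ₁ γ₂) 0 t = curveLength γ₁ 0 1 + curveLength γ₂ 0 (2 * t - 1) := by
  rw [← curveLength_add _ (by norm_num : (0 : ℝ) ≤ 1 / 2) ht, curveLength_concat_left _ _ le_rfl,
    curveLength_concat_right h12 le_rfl]
  norm_num

theorem curveLength_concat_one {γ₁ γ₂ : ℝ → ℂ} (h12 : γ₁ 1 = γ₂ 0) {t : ℝ}
    (ht : t ≤ 1 / 2) :
    curveLength (concat γ₁ γ₂) t 1 = curveLength γ₁ (2 * t) 1 + curveLength γ₂ 0 1 := by
  rw [← curveLength_add _ ht (by norm_num : (1 / 2 : ℝ) ≤ 1), curveLength_concat_left _ _ le_rfl,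
    curveLength_concat_right h12 le_rfl]
  norm_num

theorem curveLength_concat {γ₁ γ₂ : ℝ → ℂ} (h12 : γ₁ 1 = γ₂ 0) :
    curveLength (concat γ₁ γ₂) 0 1 = curveLength γ₁ 0 1 + curveLength γ₂ 0 1 := by
  rw [curveLength_concat_zero h12 (by norm_num)]
  norm_num

section

variable {Ω D N : Set ℂ} {a b c : ℂ} {γ γ₁ γ₂ : ℝ → ℂ}

theorem IsCurveIn.mono (h : IsCurveIn Ω a b γ) (hD : Ω ⊆ D) : IsCurveIn D a b γ :=
  ⟨h.1, h.2.mono_right hD, h.3, h.4⟩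

theorem IsCurveIn.rev (h : IsCurveIn Ω a b γ) : IsCurveIn Ω b a (rev γ) where
  continuousOn := by
    refine h.continuousOn.comp (by fun_prop) fun t ht => ⟨?_, ?_⟩ <;> linarith [ht.1, ht.2]
  mapsTo t ht := h.mapsTo ⟨by linarith [ht.2], by linarith [ht.1]⟩
  source := by simp [InnerUniform.rev, h.target]
  target := by simp [InnerUniform.rev, h.source]

theorem IsCurveIn.concat (h₁ : IsCurveIn Ω a b γ₁) (h₂ : IsCurveIn Ω b c γ₂) :
    IsCurveIn Ω a c (concat γ₁ γ₂) where
  continuousOn := by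
    have e : Icc (0 : ℝ) 1 = Icc 0 (1 / 2) ∪ Icc (1 / 2) 1 :=
      (Icc_union_Icc_eq_Icc (by norm_num) (by norm_num)).symm
    rw [e]
    refine ContinuousOn.union_of_isClosed ?_ ?_ isClosed_Icc isClosed_Icc
    · have : ContinuousOn (fun t => γ₁ (2 * t)) (Icc 0 (1 / 2)) :=
        h₁.continuousOn.comp (by fun_prop) fun t ht => ⟨by linarith [ht.1], by linarith [ht.2]⟩
      exact this.congr fun t ht => by simp only [InnerUniform.concat, if_pos ht.2]
    · have : ContinuousOn (fun t => γ₂ (2 * t - 1)) (Icc (1 / 2) 1) :=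
        h₂.continuousOn.comp (by fun_prop) fun t ht => ⟨by linarith [ht.1], by linarith [ht.2]⟩
      refine this.congr fun t ht => ?_
      rcases eq_or_lt_of_le ht.1 with rfl | hlt
      · simp [InnerUniform.concat, h₁.target, h₂.source]
      · simp only [InnerUniform.concat, if_neg (not_le.2 hlt)]
  mapsTo t ht := by
    by_cases h : t ≤ 1 / 2
    · simp only [InnerUniform.concat, if_pos h]
      exact h₁.mapsTo ⟨by linarith [ht.1], by linarith⟩
    · simp only [InnerUniform.concat, if_neg h]
      push Not at h
      exact h₂.mapsTo ⟨by linarith, by linarith [ht.2]⟩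
  source := by simp [InnerUniform.concat, h₁.source]
  target := by
    rw [InnerUniform.concat, if_neg (by norm_num)]
    norm_num [h₂.target]

theorem isCurveIn_const (ha : a ∈ Ω) : IsCurveIn Ω a a fun _ => a :=
  ⟨continuousOn_const, fun _ _ => ha, rfl, rfl⟩

theorem curveLength_const (s t : ℝ) : curveLength (fun _ => a) s t = 0 :=
  eVariationOn.constant_on (by
    rintro _ ⟨x, _, rfl⟩ _ ⟨y, _, rfl⟩
    rfl)

/-- The linear parametrization of a segment. -/
noncomputable def seg (a b : ℂ) (t : ℝ) : ℂ := a + (t : ℂ) * (b - a)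

theorem isCurveIn_seg (h : segment ℝ a b ⊆ Ω) : IsCurveIn Ω a b (seg a b) where
  continuousOn := by unfold seg; fun_prop
  mapsTo t ht := h (by
    rw [segment_eq_image']
    exact ⟨t, ht, by simp [seg]⟩)
  source := by simp [seg]
  target := by simp [seg]

theorem curveLength_seg_le (s t : ℝ) (hs : 0 ≤ s) (ht : t ≤ 1) :
    curveLength (seg a b) s t ≤ edist a b := by
  have hl : LipschitzOnWith (nndist a b) (seg a b) (Icc 0 1) := by
    refine LipschitzOnWith.of_dist_le_mul fun x _ y _ => ?_
    simp only [seg, dist_eq_norm, coe_nndist]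
    rw [show a + (x : ℂ) * (b - a) - (a + y * (b - a)) = ((x - y : ℝ) : ℂ) * (b - a) by
      push_cast; ring, norm_mul, Complex.norm_real, mul_comm, norm_sub_rev b a]
  have h1 := hl.comp_eVariationOn_le (g := id) (s := Icc (0:ℝ) 1) (fun x hx => hx)
  have h2 : eVariationOn (id : ℝ → ℝ) (Icc 0 1) = 1 := by
    simpa only [inter_self, id_eq, sub_zero, ENNReal.ofReal_one] using
      (monotone_id.monotoneOn (Icc (0 : ℝ) 1)).eVariationOn_eq
        (left_mem_Icc.2 zero_le_one) (right_mem_Icc.2 zero_le_one)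
  calc curveLength (seg a b) s t ≤ curveLength (seg a b) 0 1 := curveLength_mono _ hs ht
    _ ≤ (nndist a b : ℝ≥0∞) * eVariationOn (id : ℝ → ℝ) (Icc 0 1) := h1
    _ = edist a b := by rw [h2, mul_one, edist_nndist]

/-! ### The inner metric -/

theorem innerDist_le (h : IsCurveIn Ω a b γ) : innerDist Ω a b ≤ curveLength γ 0 1 :=
  iInf₂_le γ h

theorem exists_curve_of_innerDist_lt {r : ℝ≥0∞} (h : innerDist Ω a b < r) :
    ∃ γ, IsCurveIn Ω a b γ ∧ curveLength γ 0 1 < r := by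
  simpa only [innerDist, iInf_lt_iff, exists_prop] using h

theorem edist_le_innerDist : edist a b ≤ innerDist Ω a b := by
  refine le_iInf₂ fun γ h => ?_
  have := edist_le_curveLength γ zero_le_one
  rwa [h.source, h.target] at this

theorem innerDist_comm (Ω : Set ℂ) (a b : ℂ) : innerDist Ω a b = innerDist Ω b a := by
  have key : ∀ a b, innerDist Ω a b ≤ innerDist Ω b a := fun a b =>
    le_iInf₂ fun γ h => by
      have := innerDist_le h.rev
      rw [curveLength_rev] at this
      simpa using this
  exact le_antisymm (key _ _) (key _ _)

theorem innerDist_triangle (Ω : Set ℂ) (a b c : ℂ) :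
    innerDist Ω a c ≤ innerDist Ω a b + innerDist Ω b c := by
  refine ENNReal.le_of_forall_pos_le_add fun ε hε hlt => ?_
  have hε2 : (ε / 2 : ℝ≥0∞) ≠ 0 := by simp [hε.ne']
  have h1 : innerDist Ω a b ≠ ∞ := fun h => by simp [h] at hlt
  have h2 : innerDist Ω b c ≠ ∞ := fun h => by simp [h] at hlt
  obtain ⟨γ₁, c₁, l₁⟩ := exists_curve_of_innerDist_lt (ENNReal.lt_add_right h1 hε2)
  obtain ⟨γ₂, c₂, l₂⟩ := exists_curve_of_innerDist_lt (ENNReal.lt_add_right h2 hε2)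
  have := innerDist_le (c₁.concat c₂)
  rw [curveLength_concat (c₁.target.trans c₂.source.symm)] at this
  calc innerDist Ω a c ≤ _ := this
    _ ≤ (innerDist Ω a b + ε / 2) + (innerDist Ω b c + ε / 2) := add_le_add l₁.le l₂.le
    _ = innerDist Ω a b + innerDist Ω b c + (ε / 2 + ε / 2) := by ring
    _ = innerDist Ω a b + innerDist Ω b c + ε := by rw [ENNReal.add_halves]

theorem innerDist_le_edist (h : segment ℝ a b ⊆ Ω) : innerDist Ω a b ≤ edist a b :=
  (innerDist_le (isCurveIn_seg h)).trans (curveLength_seg_le 0 1 le_rfl le_rfl)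

theorem innerDist_self (h : a ∈ Ω) : innerDist Ω a a = 0 := by
  have := innerDist_le_edist (Ω := Ω) (a := a) (b := a) (by simpa using h)
  simpa using this

theorem innerDist_le_edist_of_ball {r : ℝ} (h : ball a r ⊆ Ω) (hb : dist b a < r) :
    innerDist Ω a b ≤ edist a b := by
  refine innerDist_le_edist (((convex_ball a r).segment_subset ?_ hb).trans h)
  exact mem_ball_self (dist_nonneg.trans_lt hb)

/-- Having finite inner distance is an equivalence relation, and its classes are open because of
straight segments in small disks. -/
theorem innerDist_lt_top (hN : IsOpen N) {S : Set ℂ} (hS : IsPreconnected S) (hSN : S ⊆ N)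
    (ha : a ∈ S) (hb : b ∈ S) : innerDist N a b < ∞ := by
  refine hS.induction₂ (fun x y => innerDist N x y < ∞) (fun x hx => ?_) (fun x y z _ _ _ h1 h2 => ?_)
    (fun x y _ _ h => by rwa [innerDist_comm]) ha hb
  · obtain ⟨r, hr, hrN⟩ := Metric.isOpen_iff.1 hN x (hSN hx)
    filter_upwards [mem_nhdsWithin_of_mem_nhds (ball_mem_nhds x hr)] with y hy
    exact (innerDist_le_edist_of_ball hrN hy).trans_lt (edist_lt_top _ _)
  · exact (innerDist_triangle N x y z).trans_lt (ENNReal.add_lt_top.2 ⟨h1, h2⟩)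

theorem IsCurveIn.innerDist_le_curveLength (h : IsCurveIn Ω a b γ) {s t : ℝ} (hs : 0 ≤ s)
    (hst : s ≤ t) (ht : t ≤ 1) : innerDist Ω (γ s) (γ t) ≤ curveLength γ s t := by
  rcases eq_or_lt_of_le hst with rfl | hlt
  · rw [innerDist_self (h.mapsTo ⟨hs, ht⟩)]
    exact zero_le
  have hc : IsCurveIn Ω (γ s) (γ t) (fun x => γ ((t - s) * x + s)) := by
    have hm : MapsTo (fun x => (t - s) * x + s) (Icc 0 1) (Icc 0 1) := fun x hx =>
      ⟨by nlinarith [hx.1, hx.2], by nlinarith [hx.1, hx.2]⟩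
    exact ⟨h.continuousOn.comp (by fun_prop) hm, h.mapsTo.comp hm, by simp, by simp⟩
  have := innerDist_le hc
  rw [curveLength_affine γ (sub_pos.2 hlt)] at this
  simpa using this

/-- The inner distance to a fixed point, as a real function, is continuous. -/
theorem continuousOn_innerDist_toReal (hN : IsOpen N) {S : Set ℂ} (hS : IsPreconnected S)
    (hSN : S ⊆ N) (ha : a ∈ S) : ContinuousOn (fun z => (innerDist N a z).toReal) S := by
  intro x hx
  obtain ⟨r, hr, hrN⟩ := Metric.isOpen_iff.1 hN x (hSN hx)
  rw [Metric.continuousWithinAt_iff]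
  intro ε hε
  refine ⟨min r ε, lt_min hr hε, fun y hy hyx => ?_⟩
  have h1 := innerDist_le_edist_of_ball hrN (lt_of_lt_of_le hyx (min_le_left _ _))
  have hx' := (innerDist_lt_top hN hS hSN ha hx).ne
  have hy' := (innerDist_lt_top hN hS hSN ha hy).ne
  have hxy' := (innerDist_lt_top hN hS hSN hx hy).ne
  have hr1 : (innerDist N x y).toReal ≤ dist x y := by
    rw [edist_dist] at h1
    exact ENNReal.toReal_le_of_le_ofReal dist_nonneg h1
  have h2 : (innerDist N a y).toReal ≤ (innerDist N a x).toReal + (innerDist N x y).toReal := by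
    rw [← ENNReal.toReal_add hx' hxy']
    exact ENNReal.toReal_mono (ENNReal.add_ne_top.2 ⟨hx', hxy'⟩) (innerDist_triangle N a x y)
  have h3 : (innerDist N a x).toReal ≤ (innerDist N a y).toReal + (innerDist N x y).toReal := by
    rw [← ENNReal.toReal_add hy' hxy', innerDist_comm N x y]
    rw [innerDist_comm N x y] at hxy'
    exact ENNReal.toReal_mono (ENNReal.add_ne_top.2 ⟨hy', hxy'⟩) (innerDist_triangle N a y x)
  have h4 := lt_of_lt_of_le hyx (min_le_right r ε)
  rw [dist_comm] at h4
  rw [Real.dist_eq, abs_sub_lt_iff]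
  constructor <;> linarith

/-! ### Distance to the boundary -/

theorem inter_frontier_nonempty_of_isPreconnected {X : Type*} [TopologicalSpace X] {C U : Set X}
    (hC : IsPreconnected C) (h₁ : (C ∩ U).Nonempty) (h₂ : (C ∩ Uᶜ).Nonempty) :
    (C ∩ frontier U).Nonempty := by
  by_contra hne
  rw [not_nonempty_iff_eq_empty] at hne
  have hf : ∀ z ∈ C, z ∉ frontier U := fun z hz hzf =>
    (eq_empty_iff_forall_notMem.1 hne z) ⟨hz, hzf⟩
  obtain ⟨x, hxC, hxU⟩ := h₁
  obtain ⟨y, hyC, hyU⟩ := h₂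
  have hint : ∀ z ∈ C, z ∈ U → z ∈ interior U := fun z hz hzU => by
    by_contra hn
    exact hf z hz ⟨subset_closure hzU, hn⟩
  have hcl : ∀ z ∈ C, z ∉ U → z ∈ (closure U)ᶜ := fun z hz hzU hn =>
    hf z hz ⟨hn, fun hi => hzU (interior_subset hi)⟩
  obtain ⟨z, -, hz1, hz2⟩ := hC _ _ isOpen_interior isClosed_closure.isOpen_compl
    (fun z hz => (em (z ∈ U)).imp (hint z hz) (hcl z hz)) ⟨x, hxC, hint x hxC hxU⟩
    ⟨y, hyC, hcl y hyC hyU⟩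
  exact hz2 (subset_closure (interior_subset hz1))

theorem exists_mem_frontier_segment {x y : ℂ} (hx : x ∈ Ω) (hy : y ∉ Ω) :
    ∃ z ∈ segment ℝ x y, z ∈ frontier Ω :=
  inter_frontier_nonempty_of_isPreconnected (convex_segment x y).isPreconnected
    ⟨x, left_mem_segment ℝ x y, hx⟩ ⟨y, right_mem_segment ℝ x y, hy⟩

theorem infEDist_frontier_le {x y : ℂ} (hx : x ∈ Ω) (hy : y ∉ Ω) :
    infEDist x (frontier Ω) ≤ edist x y := by
  obtain ⟨z, hz, hzf⟩ := exists_mem_frontier_segment hx hy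
  refine (infEDist_le_edist_of_mem hzf).trans ?_
  rw [edist_dist, edist_dist]
  refine ENNReal.ofReal_le_ofReal ?_
  have := dist_add_dist_of_mem_segment hz
  linarith [dist_nonneg (x := z) (y := y)]

theorem le_infEDist_frontier_of_ball (hD : IsOpen D) {x : ℂ} {r : ℝ} (h : ball x r ⊆ D) :
    ENNReal.ofReal r ≤ infEDist x (frontier D) := by
  rw [le_infEDist]
  intro y hy
  rw [edist_dist]
  refine ENNReal.ofReal_le_ofReal (not_lt.1 fun hlt => ?_)
  have : y ∈ D := h (by rwa [mem_ball, dist_comm])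
  rw [hD.frontier_eq] at hy
  exact hy.2 this

theorem ball_subset_of_le_infEDist {x : ℂ} {r : ℝ} (hx : x ∈ Ω)
    (h : ENNReal.ofReal r ≤ infEDist x (frontier Ω)) : ball x r ⊆ Ω := by
  intro y hy
  by_contra hyn
  have := h.trans (infEDist_frontier_le hx hyn)
  rw [edist_dist, ENNReal.ofReal_le_ofReal_iff dist_nonneg, dist_comm] at this
  exact absurd hy (not_lt.2 this)

theorem infEDist_frontier_mono (hD : IsOpen D) (h : Ω ⊆ D) {x : ℂ} (hx : x ∈ Ω) :
    infEDist x (frontier Ω) ≤ infEDist x (frontier D) := by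
  rw [le_infEDist]
  intro y hy
  rw [hD.frontier_eq] at hy
  exact infEDist_frontier_le hx fun hy' => hy.2 (h hy')

end

/-! ### Planar topology through continuous logarithms -/

/-- The difference of two logarithms takes values in 2πiℤ, where values less than 1 apart coincide;
so it is locally constant. -/
theorem eq_of_exp_eq_of_isPreconnected {X : Type*} [TopologicalSpace X] {S : Set X}
    (hS : IsPreconnected S) {f g : X → ℂ} (hf : ContinuousOn f S) (hg : ContinuousOn g S)
    (he : ∀ x ∈ S, Complex.exp (f x) = Complex.exp (g x)) {x y : X} (hx : x ∈ S) (hy : y ∈ S) :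
    f x - g x = f y - g y := by
  refine hS.induction₂ (fun x y => f x - g x = f y - g y) (fun x hx => ?_)
    (fun x y z _ _ _ h1 h2 => h1.trans h2) (fun x y _ _ h => h.symm) hx hy
  have hc : ContinuousOn (fun z => f z - g z) S := hf.sub hg
  filter_upwards [hc x hx (ball_mem_nhds _ one_pos), self_mem_nhdsWithin] with y hy hyS
  have hy' : ‖(f y - g y) - (f x - g x)‖ < 1 := by rw [← dist_eq_norm]; exact hy
  have h1 : Complex.exp ((f y - g y) - (f x - g x)) = 1 := by
    rw [Complex.exp_sub, Complex.exp_sub, Complex.exp_sub, he x hx, he y hyS]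
    simp
  obtain ⟨n, hn⟩ := Complex.exp_eq_one_iff.1 h1
  have hn0 : n = 0 := by
    by_contra hne
    rw [hn] at hy'
    have h2 : (1 : ℝ) ≤ |(n : ℝ)| := by exact_mod_cast Int.one_le_abs hne
    have h3 : ‖(n : ℂ) * (2 * Real.pi * Complex.I)‖ = |(n : ℝ)| * (2 * Real.pi) := by
      simp [abs_of_pos Real.pi_pos]
    rw [h3] at hy'
    nlinarith [Real.pi_gt_three]
  rw [hn0] at hn
  simp only [Int.cast_zero, zero_mul] at hn
  linear_combination -hn

/-- A continuous nonvanishing function on the plane does not agree with `z - p` near infinity. -/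
theorem not_exists_continuous_extension {h : ℂ → ℂ} (hc : Continuous h) (h0 : ∀ z, h z ≠ 0)
    {p : ℂ} {R : ℝ} (hR : 0 < R) (hz : ∀ z, R ≤ dist z p → h z = z - p) : False := by
  have hsc : IsSimplyConnected (univ : Set ℂ) := by
    have : ContractibleSpace (univ : Set ℂ) :=
      convex_univ.contractibleSpace univ_nonempty
    exact SimplyConnectedSpace.ofContractible _
  obtain ⟨g, hg, hgh⟩ := Complex.exists_continuousOn_eqOn_exp_comp (U := (univ : Set ℂ))
    hsc isOpen_univ hc.continuousOn (by rintro ⟨z, _, hz⟩; exact h0 z hz)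
  rw [continuousOn_univ] at hg
  let c : ℝ → ℂ := fun θ => p + R * Complex.exp (θ * Complex.I)
  have hcc : Continuous c := by fun_prop
  have hcR : ∀ θ, h (c θ) = R * Complex.exp (θ * Complex.I) := fun θ => by
    rw [hz]
    · simp [c]
    · simp [c, dist_eq_norm, Complex.norm_exp_ofReal_mul_I, abs_of_pos hR]
  have hconst := eq_of_exp_eq_of_isPreconnected (isPreconnected_univ (α := ℝ))
    (f := fun θ => g (c θ)) (g := fun θ => Complex.log R + θ * Complex.I)
    (by fun_prop) (by fun_prop) (fun θ _ => by
      have h1 : Complex.exp (g (c θ)) = h (c θ) := hgh (mem_univ _)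
      have hR' : (R : ℂ) ≠ 0 := by exact_mod_cast hR.ne'
      rw [h1, hcR, Complex.exp_add, Complex.exp_log hR'])
    (mem_univ 0) (mem_univ (2 * Real.pi))
  -- The lifted logarithm is periodic in θ, whereas log R + iθ is not.
  have hper : c (2 * Real.pi) = c 0 := by
    simp [c, Complex.exp_two_pi_mul_I]
  simp only [hper] at hconst
  refine Complex.two_pi_I_ne_zero ?_
  push_cast at hconst
  linear_combination hconst

theorem one_sub_div_mem_slitPlane {u v : ℂ} (h : ‖u‖ < ‖v‖) : 1 - u / v ∈ Complex.slitPlane := by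
  rw [sub_eq_add_neg]
  refine Complex.mem_slitPlane_of_norm_lt_one ?_
  rw [norm_neg, norm_div]
  exact (div_lt_one ((norm_nonneg _).trans_lt h)).2 h

/-- If a connected set `C` misses the compact set `K`, then `(z - a) / (z - b)` has a continuous
logarithm on `K` for all `a, b ∈ C`. -/
theorem exists_continuousOn_log_ratio {K C : Set ℂ} (hK : IsCompact K) (hC : IsPreconnected C)
    (hd : Disjoint K C) {a b : ℂ} (ha : a ∈ C) (hb : b ∈ C) :
    ∃ g : ℂ → ℂ, ContinuousOn g K ∧ ∀ z ∈ K, Complex.exp (g z) = (z - a) / (z - b) := by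
  have hne : ∀ z ∈ K, ∀ x ∈ C, z - x ≠ 0 := fun z hz x hx h =>
    disjoint_left.1 hd hz (sub_eq_zero.1 h ▸ hx)
  -- Existence of the logarithm is an equivalence relation in (a, b). Its classes in C are
  -- relatively open, since for y near x the ratio (z - y)/(z - x) stays within 1 of 1 on K.
  refine hC.induction₂ (fun a b => ∃ g : ℂ → ℂ, ContinuousOn g K ∧
    ∀ z ∈ K, Complex.exp (g z) = (z - a) / (z - b)) (fun x hx => ?_)
    (fun x y z hx hy hz ⟨g, hg, hge⟩ ⟨k, hk, hke⟩ => ⟨fun z => g z + k z, hg.add hk, fun w hw => ?_⟩)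
    (fun x y hx hy ⟨g, hg, hge⟩ => ⟨fun z => -g z, hg.neg, fun z hz => ?_⟩) ha hb
  · obtain ⟨r, hr, hrK⟩ := Metric.isOpen_iff.1 hK.isClosed.isOpen_compl x (disjoint_right.1 hd hx)
    filter_upwards [mem_nhdsWithin_of_mem_nhds (ball_mem_nhds x hr), self_mem_nhdsWithin] with y hy hyC
    have hs : ∀ z ∈ K, (z - y) / (z - x) ∈ Complex.slitPlane := fun z hz => by
      have h1 : (z - y) / (z - x) = 1 - (y - x) / (z - x) := by
        field_simp [hne z hz x hx]
        ring
      rw [h1]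
      refine one_sub_div_mem_slitPlane ?_
      rw [← dist_eq_norm, ← dist_eq_norm]
      exact lt_of_lt_of_le hy (not_lt.1 fun h => hrK h hz)
    refine ⟨fun z => -Complex.log ((z - y) / (z - x)), ContinuousOn.neg (ContinuousOn.clog
      (ContinuousOn.div (by fun_prop) (by fun_prop) fun z hz => hne z hz x hx) hs), fun z hz => ?_⟩
    rw [Complex.exp_neg, Complex.exp_log (Complex.slitPlane_ne_zero (hs z hz)), inv_div]
  · rw [Complex.exp_add, hge w hw, hke w hw]
    field_simp [hne w hw y hy, hne w hw z hz]
  · rw [Complex.exp_neg, hge z hz, inv_div]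

/-- If a connected set `S` misses the domain `Ω`, then `(z - a) / (z - b)` has a continuous
logarithm on `Ω` for all `a, b ∈ S`. -/
theorem exists_continuousOn_log_ratio_of_domain {Ω S : Set ℂ} (hΩ : IsPlanarDomain Ω)
    (hS : IsPreconnected S) (hd : Disjoint Ω S) {a b : ℂ} (ha : a ∈ S) (hb : b ∈ S) :
    ∃ g : ℂ → ℂ, ContinuousOn g Ω ∧ ∀ z ∈ Ω, Complex.exp (g z) = (z - a) / (z - b) := by
  obtain ⟨z₀, hz₀⟩ := hΩ.isConnected.nonempty
  -- Prescribing the value at z₀ makes the logarithm unique on each compact connected K through z₀,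
  -- so that these logarithms fit together.
  let good : Set ℂ → (ℂ → ℂ) → Prop := fun K g => IsCompact K ∧ IsPreconnected K ∧ K ⊆ Ω ∧
    z₀ ∈ K ∧ ContinuousOn g K ∧ (∀ z ∈ K, Complex.exp (g z) = (z - a) / (z - b)) ∧
    g z₀ = Complex.log ((z₀ - a) / (z₀ - b))
  have hne : ∀ z ∈ Ω, ∀ x ∈ S, z - x ≠ 0 := fun z hz x hx h =>
    disjoint_left.1 hd hz (sub_eq_zero.1 h ▸ hx)
  have hex : ∀ K, IsCompact K → IsPreconnected K → K ⊆ Ω → z₀ ∈ K → ∃ g, good K g := by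
    intro K h1 h2 h3 h4
    obtain ⟨g, hg, hge⟩ := exists_continuousOn_log_ratio h1 hS (hd.mono_left h3) ha hb
    refine ⟨fun z => g z + (Complex.log ((z₀ - a) / (z₀ - b)) - g z₀), h1, h2, h3, h4,
      hg.add continuousOn_const, fun z hz => ?_, by ring⟩
    rw [Complex.exp_add, Complex.exp_sub, hge z hz, hge z₀ h4, Complex.exp_log, div_self, mul_one]
    all_goals exact div_ne_zero (hne _ hz₀ _ ha) (hne _ hz₀ _ hb)
  have huniq : ∀ K K' g g', good K g → good K' g' → K ⊆ K' → EqOn g g' K := by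
    rintro K K' g g' ⟨-, h2, -, h4, h5, h6, h7⟩ ⟨-, -, -, -, h5', h6', h7'⟩ hKK z hz
    have := eq_of_exp_eq_of_isPreconnected h2 h5 (h5'.mono hKK)
      (fun x hx => (h6 x hx).trans (h6' x (hKK hx)).symm) hz h4
    rw [h7, h7', sub_self] at this
    exact sub_eq_zero.1 this
  have hagree : ∀ K K' g g' z, good K g → good K' g' → z ∈ K → z ∈ K' → g z = g' z := by
    intro K K' g g' z h h' hz hz'
    obtain ⟨m, hm⟩ := hex (K ∪ K') (h.1.union h'.1)
      (h.2.1.union z₀ h.2.2.2.1 h'.2.2.2.1 h'.2.1)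
      (union_subset h.2.2.1 h'.2.2.1) (Or.inl h.2.2.2.1)
    rw [huniq _ _ _ _ h hm subset_union_left hz, huniq _ _ _ _ h' hm subset_union_right hz']
  have hpath : ∀ z ∈ Ω, ∃ K, ∃ g, good K g ∧ z ∈ K := by
    intro z hz
    have hp : IsPathConnected Ω := hΩ.isOpen.isConnected_iff_isPathConnected.1 hΩ.isConnected
    obtain ⟨p, hp⟩ := hp.joinedIn z₀ hz₀ z hz
    obtain ⟨g, hg⟩ := hex (range p) (isCompact_range p.continuous)
      (isPreconnected_range p.continuous) (range_subset_iff.2 hp) ⟨0, p.source⟩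
    exact ⟨_, g, hg, 1, p.target⟩
  choose! K g hg hzK using hpath
  refine ⟨fun z => g z z, fun w hw => ?_, fun z hz => (hg z hz).2.2.2.2.2.1 z (hzK z hz)⟩
  obtain ⟨r, hr, hrΩ⟩ := Metric.nhds_basis_closedBall.mem_iff.1 (hΩ.isOpen.mem_nhds hw)
  obtain ⟨m, hm⟩ := hex (K w ∪ closedBall w r) ((hg w hw).1.union (isCompact_closedBall w r))
    ((hg w hw).2.1.union w (hzK w hw) (mem_closedBall_self hr.le)
      (convex_closedBall w r).isPreconnected)
    (union_subset (hg w hw).2.2.1 hrΩ) (Or.inl (hg w hw).2.2.2.1)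
  have hB : closedBall w r ∈ 𝓝 w := closedBall_mem_nhds w hr
  have hmc : ContinuousAt m w :=
    (hm.2.2.2.2.1.mono subset_union_right).continuousAt hB
  refine (hmc.congr ?_).continuousWithinAt
  filter_upwards [hB] with z hz
  exact hagree _ _ _ _ z hm (hg z (hrΩ hz)) (Or.inr hz) (hzK z (hrΩ hz))

/-- Separation of a compact set `Y` into two compact pieces along its components. -/
theorem exists_compact_partition {Y F H : Set ℂ} (hY : IsCompact Y) (hF : IsClosed F)
    (hH : IsCompact H) (hHY : H ⊆ Y)
    (hcomp : ∀ x ∈ H, Disjoint (connectedComponentIn Y x) F) :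
    ∃ P Q : Set ℂ, IsCompact P ∧ IsCompact Q ∧ P ∪ Q = Y ∧ Disjoint P Q ∧ H ⊆ P ∧
      Disjoint P F := by
  have : CompactSpace Y := isCompact_iff_compactSpace.1 hY
  have hloc : ∀ x : Y, (x : ℂ) ∈ H → ∃ Z : Set Y, IsClopen Z ∧ x ∈ Z ∧
      Disjoint Z ((↑) ⁻¹' F) := by
    intro x hx
    have hF' : IsCompact (((↑) : Y → ℂ) ⁻¹' F) :=
      (hF.preimage continuous_subtype_val).isCompact
    -- In a compact Hausdorff space a component is the intersection of the clopen sets around it;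
    -- compactness of F ∩ Y then yields a single clopen set missing F.
    have hemp : (((↑) : Y → ℂ) ⁻¹' F) ∩
        ⋂ s : { s : Set Y // IsClopen s ∧ x ∈ s }, (s : Set Y) = ∅ := by
      rw [← connectedComponent_eq_iInter_isClopen]
      refine eq_empty_iff_forall_notMem.2 fun y hy => ?_
      refine disjoint_left.1 (hcomp x hx) ?_ hy.1
      rw [connectedComponentIn_eq_image x.2]
      exact ⟨y, hy.2, rfl⟩
    have hdir : Directed (· ⊇ ·) fun s : { s : Set Y // IsClopen s ∧ x ∈ s } => (s : Set Y) :=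
      fun s t => ⟨⟨s.1 ∩ t.1, s.2.1.inter t.2.1, s.2.2, t.2.2⟩, inter_subset_left,
        inter_subset_right⟩
    have : Nonempty { s : Set Y // IsClopen s ∧ x ∈ s } := ⟨univ, isClopen_univ, mem_univ _⟩
    obtain ⟨s, hs⟩ := hF'.elim_directed_family_closed _ (fun s => s.2.1.isClosed)
      hemp hdir
    refine ⟨s, s.2.1, s.2.2, disjoint_left.2 fun y hy hyF => ?_⟩
    exact (eq_empty_iff_forall_notMem.1 hs y) ⟨hyF, hy⟩
  choose! Z hZ hxZ hZF using hloc
  have hH' : IsCompact (((↑) : Y → ℂ) ⁻¹' H) :=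
    (hH.isClosed.preimage continuous_subtype_val).isCompact
  obtain ⟨t, ht, hcov⟩ := hH'.elim_nhds_subcover Z fun x hx => (hZ x hx).isOpen.mem_nhds (hxZ x hx)
  let P : Set Y := ⋃ x ∈ t, Z x
  have hP : IsClopen P := t.finite_toSet.isClopen_biUnion fun x hx => hZ x (ht x hx)
  refine ⟨(↑) '' P, (↑) '' Pᶜ, hP.isClosed.isCompact.image continuous_subtype_val,
    hP.compl.isClosed.isCompact.image continuous_subtype_val, ?_, ?_, ?_, ?_⟩
  · rw [← image_union, union_compl_self, image_univ, Subtype.range_coe]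
  · exact disjoint_image_of_injective Subtype.val_injective disjoint_compl_right
  · exact fun x hx => ⟨⟨x, hHY hx⟩, hcov hx, rfl⟩
  · rw [disjoint_left]
    rintro _ ⟨y, hy, rfl⟩ hyF
    simp only [P, mem_iUnion] at hy
    obtain ⟨x, hx, hyx⟩ := hy
    exact disjoint_left.1 (hZF x (ht x hx)) hyx hyF

/-- A form of Janiszewski's theorem: if neither of two disjoint compact sets `P`, `Q` separates
`a` from `b`, then no bounded open set with frontier in `P ∪ Q` does. -/
theorem not_separated_of_disjoint {P Q C₁ C₂ U : Set ℂ} {a b : ℂ} (hP : IsCompact P)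
    (hQ : IsCompact Q) (hPQ : Disjoint P Q) (hC₁ : IsPreconnected C₁) (hPC : Disjoint P C₁)
    (hC₂ : IsPreconnected C₂) (hQC : Disjoint Q C₂) (ha₁ : a ∈ C₁) (hb₁ : b ∈ C₁)
    (ha₂ : a ∈ C₂) (hb₂ : b ∈ C₂) (hUb : Bornology.IsBounded U)
    (hfr : frontier U ⊆ P ∪ Q) (haU : a ∈ U) (hbU : b ∉ U) : False := by
  classical
  obtain ⟨g₁, hg₁, he₁⟩ := exists_continuousOn_log_ratio hP hC₁ hPC ha₁ hb₁
  obtain ⟨g₂, hg₂, he₂⟩ := exists_continuousOn_log_ratio hQ hC₂ hQC ha₂ hb₂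
  let g : ℂ → ℂ := P.piecewise g₁ g₂
  have hgP : EqOn g g₁ P := piecewise_eqOn _ _ _
  have hgQ : EqOn g g₂ Q := fun z hz =>
    piecewise_eq_of_notMem _ _ _ (disjoint_right.1 hPQ hz)
  have hg : ContinuousOn g (P ∪ Q) :=
    ContinuousOn.union_of_isClosed (hg₁.congr hgP) (hg₂.congr hgQ) hP.isClosed hQ.isClosed
  have he : ∀ z ∈ P ∪ Q, Complex.exp (g z) = (z - a) / (z - b) := by
    rintro z (hz | hz)
    · rw [hgP hz, he₁ z hz]
    · rw [hgQ hz, he₂ z hz]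
  -- Tietze extension of the logarithm from P ∪ Q to the plane.
  obtain ⟨G, hG⟩ := ContinuousMap.exists_restrict_eq (hP.union hQ).isClosed
    ⟨(P ∪ Q).domRestrict g, continuousOn_iff_continuous_domRestrict.1 hg⟩
  have hGg : ∀ z ∈ P ∪ Q, G z = g z := fun z hz => congr($hG ⟨z, hz⟩)
  have hbf : ∀ z ∈ frontier U, z - b ≠ 0 := fun z hz h => by
    rw [sub_eq_zero] at h
    subst h
    exact (hfr hz).elim (fun h => disjoint_left.1 hPC h hb₁) (fun h => disjoint_left.1 hQC h hb₂)
  -- The two formulas agree on the frontier because exp G = (z - a)/(z - b) there. The zero b of the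
  -- first lies outside U and the zero a of the second lies in U, so neither is attained.
  have hc : Continuous (U.piecewise (fun z => Complex.exp (G z) * (z - b)) (fun z => z - a)) := by
    refine Continuous.piecewise (fun z hz => ?_) (by fun_prop) (by fun_prop)
    rw [hGg z (hfr hz), he z (hfr hz), div_mul_cancel₀ _ (hbf z hz)]
  obtain ⟨R, hR, hUR⟩ := hUb.subset_ball_lt 0 a
  refine not_exists_continuous_extension hc (fun z => ?_) (p := a) hR fun z hz => ?_
  · by_cases hz : z ∈ U
    · rw [piecewise_eq_of_mem _ _ _ hz]
      refine mul_ne_zero (Complex.exp_ne_zero _) fun h => hbU ?_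
      rwa [sub_eq_zero.1 h] at hz
    · rw [piecewise_eq_of_notMem _ _ _ hz]
      exact fun h => hz (sub_eq_zero.1 h ▸ haU)
  · exact piecewise_eq_of_notMem _ _ _ fun h => not_lt.2 hz (hUR h)

/-! ### Chains -/

/-- The image of U contains the interval between f x and f y, which is covered by `t.card` sets of
diameter at most d; compare Lebesgue measures. The sets `O i` need be neither open nor connected,
and no chain has to be extracted. -/
theorem abs_sub_le_of_cover {X ι : Type*} [TopologicalSpace X] {U : Set X} (hU : IsPreconnected U)
    {f : X → ℝ} (hf : ContinuousOn f U) (t : Finset ι) (O : ι → Set X) {d : ℝ}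
    (hcov : ∀ x ∈ U, ∃ i ∈ t, x ∈ O i)
    (hd : ∀ i ∈ t, ∀ x ∈ U ∩ O i, ∀ y ∈ U ∩ O i, |f x - f y| ≤ d) {x y : X} (hx : x ∈ U)
    (hy : y ∈ U) : |f x - f y| ≤ t.card * d := by
  obtain ⟨i₀, hi₀, hxi⟩ := hcov x hx
  have hd0 : 0 ≤ d := (abs_nonneg _).trans (hd i₀ hi₀ x ⟨hx, hxi⟩ x ⟨hx, hxi⟩)
  have h1 : uIcc (f x) (f y) ⊆ ⋃ i ∈ t, f '' (U ∩ O i) := by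
    refine ((hU.image f hf).ordConnected.uIcc_subset (mem_image_of_mem f hx)
      (mem_image_of_mem f hy)).trans ?_
    rintro _ ⟨z, hz, rfl⟩
    obtain ⟨i, hi, hzi⟩ := hcov z hz
    exact mem_biUnion hi ⟨z, ⟨hz, hzi⟩, rfl⟩
  have h2 : ENNReal.ofReal |f y - f x| ≤ ENNReal.ofReal (t.card * d) := by
    calc ENNReal.ofReal |f y - f x| = MeasureTheory.volume (uIcc (f x) (f y)) := by
          rw [Real.volume_interval]
      _ ≤ MeasureTheory.volume (⋃ i ∈ t, f '' (U ∩ O i)) := MeasureTheory.measure_mono h1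
      _ ≤ ∑ i ∈ t, MeasureTheory.volume (f '' (U ∩ O i)) :=
          MeasureTheory.measure_biUnion_finset_le _ _
      _ ≤ ∑ i ∈ t, ENNReal.ofReal d := by
          refine Finset.sum_le_sum fun i hi => (Real.volume_le_diam _).trans ?_
          refine ediam_le ?_
          rintro _ ⟨u, hu, rfl⟩ _ ⟨v, hv, rfl⟩
          rw [edist_dist, Real.dist_eq]
          exact ENNReal.ofReal_le_ofReal (hd i hi u hu v hv)
      _ = ENNReal.ofReal (t.card * d) := by
          rw [Finset.sum_const, nsmul_eq_mul, ENNReal.ofReal_mul (Nat.cast_nonneg _),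
            ENNReal.ofReal_natCast]
  rw [abs_sub_comm]
  exact (ENNReal.ofReal_le_ofReal_iff (by positivity)).1 h2

theorem innerDist_le_of_cover {ι : Type*} {N U : Set ℂ} (hN : IsOpen N) (hU : IsPreconnected U)
    (hUN : U ⊆ N) (t : Finset ι) (O : ι → Set ℂ) {d : ℝ} (hcov : ∀ x ∈ U, ∃ i ∈ t, x ∈ O i)
    (hd : ∀ i ∈ t, ∀ x ∈ U ∩ O i, ∀ y ∈ U ∩ O i, innerDist N x y ≤ ENNReal.ofReal d)
    (hd0 : 0 ≤ d) {x y : ℂ} (hx : x ∈ U) (hy : y ∈ U) :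
    innerDist N x y ≤ ENNReal.ofReal (t.card * d) := by
  have hfin : ∀ u ∈ U, ∀ v ∈ U, innerDist N u v ≠ ∞ := fun u hu v hv =>
    (innerDist_lt_top hN hU hUN hu hv).ne
  have hone : ∀ u ∈ U, ∀ v ∈ U, innerDist N u v ≤ ENNReal.ofReal d →
      (innerDist N x u).toReal ≤ (innerDist N x v).toReal + d := by
    intro u hu v hv huv
    refine (ENNReal.toReal_mono (ENNReal.add_ne_top.2 ⟨hfin x hx v hv, hfin v hv u hu⟩)
      (innerDist_triangle N x v u)).trans ?_
    rw [ENNReal.toReal_add (hfin x hx v hv) (hfin v hv u hu), innerDist_comm N v u]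
    gcongr
    exact ENNReal.toReal_le_of_le_ofReal hd0 huv
  have := abs_sub_le_of_cover hU (continuousOn_innerDist_toReal hN hU hUN hx) t O hcov
    (fun i hi u hu v hv => by
      have h1 := hone u hu.1 v hv.1 (hd i hi u hu v hv)
      have h2 := hone v hv.1 u hu.1 (hd i hi v hv u hu)
      rw [abs_sub_le_iff]
      constructor <;> linarith) hy hx
  rw [innerDist_self (hUN hx), ENNReal.toReal_zero, sub_zero,
    abs_of_nonneg ENNReal.toReal_nonneg] at this
  rw [← ENNReal.ofReal_toReal (hfin x hx y hy)]
  exact ENNReal.ofReal_le_ofReal this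

/-- Every disk of radius `R` is covered by a bounded number of disks of radius `c * R`. -/
theorem exists_cover_card {c : ℝ} (hc : 0 < c) :
    ∃ k : ℕ, ∀ (p : ℂ) (R : ℝ), 0 < R → ∃ t : Finset ℂ, t.card ≤ k ∧
      ∀ z ∈ closedBall p R, ∃ q ∈ t, dist z q < c * R := by
  classical
  obtain ⟨s, -, hs, hcov⟩ := (isCompact_closedBall (0 : ℂ) 1).finite_cover_balls hc
  refine ⟨hs.toFinset.card, fun p R hR =>
    ⟨hs.toFinset.image fun q => p + R * q, Finset.card_image_le, fun z hz => ?_⟩⟩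
  have hR' : (R : ℂ) ≠ 0 := by exact_mod_cast hR.ne'
  have hz' : (z - p) / R ∈ closedBall (0 : ℂ) 1 := by
    rw [mem_closedBall_zero_iff, norm_div, Complex.norm_real, Real.norm_of_nonneg hR.le,
      div_le_one hR, ← dist_eq_norm]
    exact hz
  obtain ⟨q, hq, hzq⟩ := mem_iUnion₂.1 (hcov hz')
  refine ⟨p + R * q, Finset.mem_image.2 ⟨q, hs.mem_toFinset.2 hq, rfl⟩, ?_⟩
  rw [mem_ball, dist_eq_norm] at hzq
  rw [dist_eq_norm, show z - (p + R * q) = ((z - p) / R - q) * R by field_simp; ring, norm_mul,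
    Complex.norm_real, Real.norm_of_nonneg hR.le]
  gcongr

section

variable {A : ℝ} {Ω : Set ℂ}

theorem IsInnerUniformDomain.innerDist_lt_top (h : IsInnerUniformDomain A Ω) {a b : ℂ}
    (ha : a ∈ Ω) (hb : b ∈ Ω) : innerDist Ω a b < ∞ :=
  InnerUniform.innerDist_lt_top h.isPlanarDomain.isOpen
    h.isPlanarDomain.isConnected.isPreconnected Subset.rfl ha hb

/-- In an inner uniform domain a point can be moved away from the boundary. -/
theorem IsInnerUniformDomain.exists_far_from_boundary (hA : 1 ≤ A) (h : IsInnerUniformDomain A Ω)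
    {w y : ℂ} (hw : w ∈ Ω) (hy : y ∈ Ω) {r : ℝ} (hr : 0 < r)
    (hwy : ENNReal.ofReal (2 * r) ≤ innerDist Ω w y) :
    ∃ w' ∈ Ω, innerDist Ω w w' ≤ ENNReal.ofReal r ∧ ball w' (r / A) ⊆ Ω := by
  obtain ⟨γ, hγ⟩ := h.exists_curve w hw y hy
  have hA0 : 0 < A := by linarith
  have hΩ := h.isPlanarDomain
  have hf : ContinuousOn (fun t => (innerDist Ω w (γ t)).toReal) (Icc 0 1) :=
    (continuousOn_innerDist_toReal hΩ.isOpen hΩ.isConnected.isPreconnected Subset.rfl hw).comp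
      hγ.isCurveIn.continuousOn hγ.isCurveIn.mapsTo
  have h0 : (innerDist Ω w (γ 0)).toReal ≤ r := by
    rw [hγ.isCurveIn.source, innerDist_self hw]
    exact hr.le
  have h1 : r ≤ (innerDist Ω w (γ 1)).toReal := by
    rw [hγ.isCurveIn.target]
    have := (ENNReal.ofReal_le_iff_le_toReal (h.innerDist_lt_top hw hy).ne).1 hwy
    linarith
  -- A point of the curve at inner distance exactly r from w is at inner distance at least r from y,
  -- so both subarcs have length at least r and the cigar condition applies.
  obtain ⟨t, ht, htr⟩ := intermediate_value_Icc zero_le_one hf ⟨h0, h1⟩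
  have hγt := hγ.isCurveIn.mapsTo ht
  have heq : innerDist Ω w (γ t) = ENNReal.ofReal r := by
    rw [← htr, ENNReal.ofReal_toReal (h.innerDist_lt_top hw hγt).ne]
  refine ⟨γ t, hγt, heq.le, ball_subset_of_le_infEDist hγt ?_⟩
  have hl1 : ENNReal.ofReal r ≤ curveLength γ 0 t := by
    have := hγ.isCurveIn.innerDist_le_curveLength le_rfl ht.1 ht.2
    rwa [hγ.isCurveIn.source, heq] at this
  have hl2 : ENNReal.ofReal r ≤ curveLength γ t 1 := by
    have h2 := hγ.isCurveIn.innerDist_le_curveLength ht.1 ht.2 le_rfl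
    rw [hγ.isCurveIn.target] at h2
    have h3 := hwy.trans (innerDist_triangle Ω w (γ t) y)
    rw [two_mul, ENNReal.ofReal_add hr.le hr.le, heq] at h3
    exact (ENNReal.add_le_add_iff_left ENNReal.ofReal_ne_top).1 h3 |>.trans h2
  have h4 := (le_min hl1 hl2).trans (hγ.cigar t ht)
  rw [show r = A * (r / A) by field_simp, ENNReal.ofReal_mul hA0.le,
    ENNReal.mul_le_mul_iff_right (by simpa using hA0) ENNReal.ofReal_ne_top] at h4
  exact h4

/-- Any two points of `Ω` that are connected in `Ω ∩ ball p R` have inner distance at most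
`N * R`. -/
def InnerDistBounded (N : ℝ) (Ω : Set ℂ) : Prop :=
  ∀ U : Set ℂ, IsPreconnected U → U ⊆ Ω → ∀ (p : ℂ) (R : ℝ), 0 < R → U ⊆ ball p R →
    ∀ x ∈ U, ∀ y ∈ U, innerDist Ω x y ≤ ENNReal.ofReal (N * R)

/-- In an inner uniform domain, points that can be connected inside a disk have inner distance
comparable to the radius at most. -/
theorem exists_innerDistBounded (hA : 1 ≤ A) :
    ∃ N : ℝ, 1 ≤ N ∧ ∀ Ω : Set ℂ, IsInnerUniformDomain A Ω → InnerDistBounded N Ω := by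
  have hA0 : 0 < A := by linarith
  obtain ⟨k, hk⟩ := exists_cover_card (c := 1 / (16 * A)) (by positivity)
  refine ⟨k + 1, by simp, fun Ω h U hU hUΩ p R hR hUR x hx y hy => ?_⟩
  by_cases hM : innerDist Ω x y ≤ ENNReal.ofReal R
  · refine hM.trans (ENNReal.ofReal_le_ofReal ?_)
    nlinarith [(Nat.cast_nonneg k : (0 : ℝ) ≤ k)]
  push Not at hM
  have hfar : ∀ w ∈ U, ∃ w' ∈ Ω, innerDist Ω w w' ≤ ENNReal.ofReal (R / 4) ∧
      ball w' (R / 4 / A) ⊆ Ω := by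
    intro w hw
    -- If λ(x, y) > R, then w cannot be within R/2 of both x and y.
    have : ∃ y' ∈ Ω, ENNReal.ofReal (2 * (R / 4)) ≤ innerDist Ω w y' := by
      by_contra! hcon
      have h1 := hcon x (hUΩ hx)
      have h2 := hcon y (hUΩ hy)
      refine absurd (innerDist_triangle Ω x w y) (not_le.2 ?_)
      rw [innerDist_comm Ω x w]
      refine (ENNReal.add_lt_add h1 h2).trans ?_
      rw [← ENNReal.ofReal_add (by positivity) (by positivity)]
      ring_nf
      exact hM
    obtain ⟨y', hy', hwy'⟩ := this
    exact h.exists_far_from_boundary hA (hUΩ hw) hy' (by positivity) hwy'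
  obtain ⟨t, ht, hcov⟩ := hk p (2 * R) (by positivity)
  -- The covering radius is half the radius R/(4A) of the free disks, so points w' assigned to the
  -- same centre lie in each other's free disks. The covered disk has radius 2R because moving w to
  -- w' may leave the original one.
  have hrad : 1 / (16 * A) * (2 * R) = R / 4 / A / 2 := by field_simp; norm_num
  rw [hrad] at hcov
  have hAR : R / 4 / A ≤ R / 4 := div_le_self (by positivity) hA
  refine (innerDist_le_of_cover h.isPlanarDomain.isOpen hU hUΩ t
    (fun q => {w | ∃ w' ∈ Ω, innerDist Ω w w' ≤ ENNReal.ofReal (R / 4) ∧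
      ball w' (R / 4 / A) ⊆ Ω ∧ dist w' q < R / 4 / A / 2}) (d := R) ?_ ?_ hR.le hx hy).trans ?_
  · intro w hw
    obtain ⟨w', hw', hl, hb⟩ := hfar w hw
    have hww : dist w w' ≤ R / 4 := by
      have := edist_le_innerDist.trans hl
      rwa [edist_dist, ENNReal.ofReal_le_ofReal_iff (by positivity)] at this
    obtain ⟨q, hq, hqd⟩ := hcov w' (by
      have h1 := hUR hw
      rw [mem_ball] at h1
      rw [mem_closedBall]
      linarith [dist_triangle w' w p, dist_comm w w'])
    exact ⟨q, hq, w', hw', hl, hb, hqd⟩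
  · rintro q hq u ⟨hu, u', hu', hlu, hbu, hqu⟩ v ⟨hv, v', hv', hlv, hbv, hqv⟩
    have huv : dist v' u' < R / 4 / A := by
      linarith [dist_triangle v' q u', dist_comm q u']
    have h1 := innerDist_le_edist_of_ball hbu huv
    have h2 : innerDist Ω u' v' ≤ ENNReal.ofReal (R / 4) := by
      refine h1.trans ?_
      rw [edist_dist, dist_comm]
      exact ENNReal.ofReal_le_ofReal (by linarith)
    calc innerDist Ω u v ≤ innerDist Ω u u' + innerDist Ω u' v := innerDist_triangle _ _ _ _
      _ ≤ innerDist Ω u u' + (innerDist Ω u' v' + innerDist Ω v' v) := by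
          gcongr
          exact innerDist_triangle _ _ _ _
      _ ≤ ENNReal.ofReal (R / 4) + (ENNReal.ofReal (R / 4) + ENNReal.ofReal (R / 4)) := by
          rw [innerDist_comm Ω v' v]
          gcongr
      _ = ENNReal.ofReal (R / 4 + (R / 4 + R / 4)) := by
          rw [ENNReal.ofReal_add, ENNReal.ofReal_add] <;> positivity
      _ ≤ ENNReal.ofReal R := ENNReal.ofReal_le_ofReal (by linarith)
  · refine ENNReal.ofReal_le_ofReal ?_
    have : (t.card : ℝ) ≤ k + 1 := by exact_mod_cast ht.trans (Nat.le_succ k)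
    gcongr

end

/-! ### Relative separation of the complementary components -/

/-- Write z - s = (z - s)/(z - s') · (z - s'). The first factor has a logarithm on Ω because S joins
s to s' outside Ω; the second has one on the disk, which does not contain s'. -/
theorem exists_continuousOn_log_sub {Ω S : Set ℂ} (hΩ : IsPlanarDomain Ω)
    (hS : IsPreconnected S) (hd : Disjoint Ω S) {s s' : ℂ} (hs : s ∈ S) (hs' : s' ∈ S) {ρ : ℝ}
    (hρ : 0 < ρ) (hss : ρ ≤ dist s' s) :
    ∃ g : ℂ → ℂ, ContinuousOn g (Ω ∩ ball s ρ) ∧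
      ∀ z ∈ Ω ∩ ball s ρ, Complex.exp (g z) = z - s := by
  obtain ⟨g, hg, hge⟩ := exists_continuousOn_log_ratio_of_domain hΩ hS hd hs hs'
  have hne : s - s' ≠ 0 := by
    rw [sub_ne_zero]
    rintro rfl
    rw [dist_self] at hss
    exact absurd hss (not_le.2 hρ)
  have hslit : ∀ z ∈ Ω ∩ ball s ρ, (z - s') / (s - s') ∈ Complex.slitPlane := fun z hz => by
    rw [show (z - s') / (s - s') = 1 - (s - z) / (s - s') by field_simp; ring]
    refine one_sub_div_mem_slitPlane ?_
    rw [← dist_eq_norm, ← dist_eq_norm, dist_comm s z, dist_comm s s']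
    exact lt_of_lt_of_le hz.2 hss
  refine ⟨fun z => g z + Complex.log ((z - s') / (s - s')) + Complex.log (s - s'),
    ((hg.mono inter_subset_left).add (ContinuousOn.clog (by fun_prop) hslit)).add
      continuousOn_const, fun z hz => ?_⟩
  have h1 := Complex.slitPlane_ne_zero (hslit z hz)
  have h2 : z - s' ≠ 0 := fun h => h1 (by rw [h, zero_div])
  rw [Complex.exp_add, Complex.exp_add, hge z hz.1, Complex.exp_log h1, Complex.exp_log hne]
  field_simp

/-- Gluing a logarithm of `(z - s) / (z - t)` near `s` with the principal one far from `s`. -/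
theorem exists_log_ratio_gluing {V : Set ℂ} (hVo : IsOpen V) {s t : ℂ} {r : ℝ} (hr : 0 < r)
    (hst : dist s t < r) {L : ℂ → ℂ} (hL : ContinuousOn L V)
    (hLe : ∀ z ∈ V, Complex.exp (L z) = (z - s) / (z - t))
    (heq : ∀ z ∈ V, ∀ w ∈ connectedComponentIn V z, r < dist z s → r < dist w s →
      L z + Complex.log ((z - t) / (z - s)) = L w + Complex.log ((w - t) / (w - s))) :
    ∃ G : ℂ → ℂ, (∀ z, r < dist z s ∨ z ∈ V → Complex.exp (G z) = (z - s) / (z - t)) ∧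
      ∀ z, r < dist z s ∨ z ∈ V → ContinuousAt G z := by
  classical
  let M : ℂ → ℂ := fun z => -Complex.log ((z - t) / (z - s))
  have hzs : ∀ z, r < dist z s → z - s ≠ 0 := fun z hz h => by
    rw [sub_eq_zero.1 h, dist_self] at hz
    exact absurd hz (not_lt.2 hr.le)
  have hMslit : ∀ z, r < dist z s → (z - t) / (z - s) ∈ Complex.slitPlane := fun z hz => by
    rw [show (z - t) / (z - s) = 1 - (t - s) / (z - s) by field_simp [hzs z hz]; ring]
    refine one_sub_div_mem_slitPlane ?_
    rw [← dist_eq_norm, ← dist_eq_norm, dist_comm t s]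
    exact hst.trans hz
  have hMe : ∀ z, r < dist z s → Complex.exp (M z) = (z - s) / (z - t) := fun z hz => by
    simp only [M]
    rw [Complex.exp_neg, Complex.exp_log (Complex.slitPlane_ne_zero (hMslit z hz)), inv_div]
  have hMc : ∀ z, r < dist z s → ContinuousAt M z := fun z hz => by
    have h1 : ContinuousAt (fun w : ℂ => (w - t) / (w - s)) z := by
      have h2 : ContinuousAt (fun w : ℂ => w - t) z := by fun_prop
      have h3 : ContinuousAt (fun w : ℂ => w - s) z := by fun_prop
      exact h2.div h3 (hzs z hz)
    exact (h1.clog (hMslit z hz)).neg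
  -- For each component K of V the correction is the jump L - M at some point of K outside the disk,
  -- or 0 if there is none; by `heq` the choice of the point is immaterial.
  have hF : ∀ K : Set ℂ, ∃ c : ℂ, ((∃ w ∈ K, r < dist w s) →
      ∃ w ∈ K, r < dist w s ∧ c = L w - M w) ∧ ((¬ ∃ w ∈ K, r < dist w s) → c = 0) := fun K => by
    by_cases h : ∃ w ∈ K, r < dist w s
    · obtain ⟨w, hw, hwr⟩ := h
      exact ⟨L w - M w, fun _ => ⟨w, hw, hwr, rfl⟩, fun h => absurd ⟨w, hw, hwr⟩ h⟩
    · exact ⟨0, fun h' => absurd h' h, fun _ => rfl⟩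
  choose F hF1 hF0 using hF
  let m : ℂ → ℂ := fun z => F (connectedComponentIn V z)
  let G : ℂ → ℂ := fun z => if r < dist z s then M z else L z - m z
  have hmexp : ∀ z, Complex.exp (m z) = 1 := fun z => by
    by_cases h : ∃ w ∈ connectedComponentIn V z, r < dist w s
    · obtain ⟨w, hw, hwr, hc⟩ := hF1 _ h
      simp only [m]
      rw [hc, Complex.exp_sub, hLe _ (connectedComponentIn_subset _ _ hw), hMe _ hwr, div_self]
      rw [← hMe _ hwr]
      exact Complex.exp_ne_zero _
    · simp only [m]
      rw [hF0 _ h, Complex.exp_zero]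
  have hGV : ∀ z ∈ V, ∀ w ∈ connectedComponentIn V z, G w = L w - m z := fun z hz w hw => by
    have hcomp := connectedComponentIn_eq hw
    by_cases hwr : r < dist w s
    · obtain ⟨v, hv, hvr, hc⟩ := hF1 _ ⟨w, hw, hwr⟩
      simp only [G, if_pos hwr, m]
      have := heq w (connectedComponentIn_subset _ _ hw) v (hcomp ▸ hv) hwr hvr
      rw [hc]
      simp only [M]
      linear_combination -this
    · simp only [G, if_neg hwr, m]
      rw [hcomp]
  have hGe : ∀ z, r < dist z s ∨ z ∈ V → Complex.exp (G z) = (z - s) / (z - t) := by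
    intro z hz
    by_cases hzr : r < dist z s
    · simp only [G, if_pos hzr, hMe z hzr]
    · have hzV := hz.resolve_left hzr
      rw [hGV z hzV z (mem_connectedComponentIn hzV), Complex.exp_sub, hmexp, hLe z hzV, div_one]
  have hGc : ∀ z, r < dist z s ∨ z ∈ V → ContinuousAt G z := by
    rintro z (hz | hz)
    · refine (hMc z hz).congr ?_
      have ho : IsOpen {w | r < dist w s} := isOpen_lt continuous_const (by fun_prop)
      filter_upwards [ho.mem_nhds hz] with w hw
      simp only [G, if_pos (show r < dist w s from hw)]
    · have hLz : ContinuousAt (fun w => L w - m z) z :=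
        (hL.continuousAt (hVo.mem_nhds hz)).sub continuousAt_const
      refine hLz.congr ?_
      filter_upwards [hVo.connectedComponentIn.mem_nhds (mem_connectedComponentIn hz)] with w hw
      rw [hGV z hz w hw]
  exact ⟨G, hGe, hGc⟩

/-- A logarithm G of (z - s)/(z - t) off P ∪ Q would allow z - s to be deformed to z - t near P by
the factor exp(-ψG), with a cutoff ψ. The result avoids both zeros, since s ∈ P and t ∈ Q, and is
still z - s near infinity. -/
theorem not_exists_log_ratio_of_partition {V P Q : Set ℂ} {s t : ℂ} {r : ℝ} (hr : 0 < r)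
    (hP : IsCompact P) (hQ : IsCompact Q) (hPQ : Disjoint P Q) (hsP : s ∈ P) (htQ : t ∈ Q)
    (hPr : ∀ z ∈ P, dist z s ≤ r) (hQr : ∀ z ∈ Q, dist z s ≤ r)
    (hout : ∀ z, z ∉ P → z ∉ Q → r < dist z s ∨ z ∈ V) {G : ℂ → ℂ}
    (hGe : ∀ z, r < dist z s ∨ z ∈ V → Complex.exp (G z) = (z - s) / (z - t))
    (hGc : ∀ z, r < dist z s ∨ z ∈ V → ContinuousAt G z) : False := by
  classical
  obtain ⟨χ, hχ0, hχ1, -⟩ := exists_continuous_zero_one_of_isClosed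
    (s := Q ∪ (ball s (2 * r))ᶜ) (t := P)
    (hQ.isClosed.union isOpen_ball.isClosed_compl) hP.isClosed (by
      refine disjoint_left.2 fun z hz hzP => hz.elim (fun h => disjoint_left.1 hPQ hzP h)
        fun h => h ?_
      rw [mem_ball]
      linarith [hPr z hzP])
  -- Clipping makes the cutoff constant on neighbourhoods of P and of Q, so the behaviour of G near
  -- these sets is irrelevant.
  let ψ : ℂ → ℝ := fun z => max 0 (min 1 (3 * χ z - 1))
  have hψc : Continuous ψ := by fun_prop
  have hψ1 : ∀ z, 2 / 3 < χ z → ψ z = 1 := fun z hz => by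
    simp only [ψ]
    rw [min_eq_left (by linarith), max_eq_right zero_le_one]
  have hψ0 : ∀ z, χ z < 1 / 3 → ψ z = 0 := fun z hz => by
    simp only [ψ]
    rw [max_eq_left]
    exact (min_le_right _ _).trans (by linarith)
  let h : ℂ → ℂ := fun z =>
    if z ∈ P then z - t else if z ∈ Q then z - s else (z - s) * Complex.exp (-(ψ z * G z))
  have hs_ne : ∀ z, z ∉ P → z - s ≠ 0 := fun z hz h => hz (sub_eq_zero.1 h ▸ hsP)
  have ht_ne : ∀ z, z ∉ Q → z - t ≠ 0 := fun z hz h => hz (sub_eq_zero.1 h ▸ htQ)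
  have hc : Continuous h := by
    rw [continuous_iff_continuousAt]
    intro z
    by_cases hzP : z ∈ P
    · have hct : ContinuousAt (fun w => w - t) z := by fun_prop
      refine hct.congr ?_
      have : 2 / 3 < χ z := by
        rw [hχ1 hzP]
        norm_num
      filter_upwards [χ.continuous.continuousAt.eventually (lt_mem_nhds this)] with w hw
      by_cases hwP : w ∈ P
      · simp only [h, if_pos hwP]
      · have hwQ : w ∉ Q := fun hwQ => by
          have := hχ0 (Or.inl hwQ : w ∈ Q ∪ (ball s (2 * r))ᶜ)
          rw [this] at hw
          norm_num at hw
        simp only [h, if_neg hwP, if_neg hwQ]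
        rw [hψ1 w hw, Complex.ofReal_one, one_mul, Complex.exp_neg, hGe w (hout w hwP hwQ), inv_div,
          mul_div_cancel₀ _ (hs_ne w hwP)]
    · by_cases hzQ : z ∈ Q
      · have hct : ContinuousAt (fun w => w - s) z := by fun_prop
        refine hct.congr ?_
        have : χ z < 1 / 3 := by
          rw [hχ0 (Or.inl hzQ)]
          norm_num
        filter_upwards [χ.continuous.continuousAt.eventually (gt_mem_nhds this)] with w hw
        have hwP : w ∉ P := fun hwP => by
          rw [hχ1 hwP] at hw
          norm_num at hw
        by_cases hwQ : w ∈ Q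
        · simp only [h, if_neg hwP, if_pos hwQ]
        · simp only [h, if_neg hwP, if_neg hwQ]
          rw [hψ0 w hw]
          simp
      · have hGz := hGc z (hout z hzP hzQ)
        have hct : ContinuousAt (fun w => (w - s) * Complex.exp (-(ψ w * G w))) z := by
          fun_prop
        refine hct.congr ?_
        filter_upwards [hP.isClosed.isOpen_compl.mem_nhds hzP,
          hQ.isClosed.isOpen_compl.mem_nhds hzQ] with w hwP hwQ
        simp only [h, if_neg hwP, if_neg hwQ]
  refine not_exists_continuous_extension hc (fun z => ?_) (p := s) (R := 2 * r) (by positivity)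
    fun z hz => ?_
  · by_cases hzP : z ∈ P
    · simp only [h, if_pos hzP]
      exact ht_ne z (disjoint_left.1 hPQ hzP)
    · by_cases hzQ : z ∈ Q
      · simp only [h, if_neg hzP, if_pos hzQ]
        exact hs_ne z hzP
      · simp only [h, if_neg hzP, if_neg hzQ]
        exact mul_ne_zero (hs_ne z hzP) (Complex.exp_ne_zero _)
  · have hzP : z ∉ P := fun hzP => by linarith [hPr z hzP]
    have hzQ : z ∉ Q := fun hzQ => by linarith [hQr z hzQ]
    simp only [h, if_neg hzP, if_neg hzQ]
    rw [hψ0 z]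
    · simp
    · rw [hχ0 (Or.inr fun hb => not_lt.2 hz hb)]
      norm_num

section

variable {A : ℝ} {Ω : Set ℂ}

/-- An inner uniform curve whose endpoints are far from the boundary point `s` does not come
close to `s`. -/
theorem IsInnerUniformCurve.lt_dist_of_notMem (hA : 1 ≤ A) {a b : ℂ} {γ : ℝ → ℂ}
    (h : IsInnerUniformCurve A Ω a b γ) {s : ℂ} (hs : s ∉ Ω) {r ε : ℝ}
    (ha : r < dist a s) (hb : r < dist b s) (hε : (1 + A) * ε ≤ r) {u : ℝ} (hu : u ∈ Icc (0 : ℝ) 1) :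
    ε < dist (γ u) s := by
  by_contra! hle
  have hA0 : 0 < A := by linarith
  have h1 : ENNReal.ofReal (dist a (γ u)) ≤ curveLength γ 0 u := by
    have := edist_le_curveLength γ hu.1
    rwa [h.isCurveIn.source, edist_dist] at this
  have h2 : ENNReal.ofReal (dist (γ u) b) ≤ curveLength γ u 1 := by
    have := edist_le_curveLength γ hu.2
    rwa [h.isCurveIn.target, edist_dist] at this
  have h3 : ENNReal.ofReal A * infEDist (γ u) (frontier Ω) ≤ ENNReal.ofReal (A * ε) := by
    rw [ENNReal.ofReal_mul hA0.le]
    gcongr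
    refine (infEDist_frontier_le (h.isCurveIn.mapsTo hu) hs).trans ?_
    rw [edist_dist]
    exact ENNReal.ofReal_le_ofReal hle
  have hAε : 0 ≤ A * ε := mul_nonneg hA0.le (dist_nonneg.trans hle)
  have h4 := (min_le_min h1 h2).trans ((h.cigar u hu).trans h3)
  rw [min_le_iff, ENNReal.ofReal_le_ofReal_iff hAε, ENNReal.ofReal_le_ofReal_iff hAε] at h4
  rcases h4 with h4 | h4
  · linarith [dist_triangle a (γ u) s]
  · linarith [dist_triangle b (γ u) s, dist_comm b (γ u)]

/-- The complementary components of `Ω` are separated relative to their sizes, with constant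
`c`. -/
def RelativelySeparated (c : ℝ) (Ω : Set ℂ) : Prop :=
  ∀ (s s' t t' : ℂ) (ρ : ℝ), t ∈ Ωᶜ → t ∉ connectedComponentIn Ωᶜ s →
    s' ∈ connectedComponentIn Ωᶜ s → t' ∈ connectedComponentIn Ωᶜ t → 0 < ρ → ρ ≤ dist s' s →
    ρ ≤ dist t' t → c * ρ ≤ dist s t

/-- Distinct complementary components of an inner uniform domain are relatively separated. -/
theorem exists_relativelySeparated (hA : 1 ≤ A) :
    ∃ c : ℝ, 0 < c ∧ ∀ Ω : Set ℂ, IsInnerUniformDomain A Ω → RelativelySeparated c Ω := by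
  obtain ⟨N, hN1, hN⟩ := exists_innerDistBounded hA
  have hA0 : 0 < A := by linarith
  refine ⟨1 / ((1 + A) * (4 + 2 * A * N)), by positivity,
    fun Ω hΩ s s' t t' ρ ht hts hs' ht' hρ hss htt => ?_⟩
  by_contra! hlt
  -- A uniform curve joining two points of one component of Ω ∩ B(s, 2r) has length at most 2ANr,
  -- hence stays in B(s, (2 + 2AN)r). One further r gives ρ', and another allows for recentring at
  -- t. The factor 1 + A in the constant keeps such curves more than |s - t| away from s.
  set r := ρ / (4 + 2 * A * N) with hr_def
  have hr : 0 < r := by positivity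
  have hρr : ρ = (4 + 2 * A * N) * r := by rw [hr_def]; field_simp
  have hst' : (1 + A) * dist s t < r := by
    rw [show 1 / ((1 + A) * (4 + 2 * A * N)) * ρ = r / (1 + A) by rw [hr_def]; field_simp,
      lt_div_iff₀ (by positivity)] at hlt
    linarith
  have hst : dist s t < r := by nlinarith [dist_nonneg (x := s) (y := t)]
  have hs : s ∈ Ωᶜ := connectedComponentIn_nonempty_iff.1 ⟨s', hs'⟩
  have hdS : ∀ x, Disjoint Ω (connectedComponentIn Ωᶜ x) := fun x =>
    disjoint_left.2 fun z hz hz' => connectedComponentIn_subset _ _ hz' hz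
  obtain ⟨g₁, hg₁, he₁⟩ := exists_continuousOn_log_sub hΩ.isPlanarDomain
    isPreconnected_connectedComponentIn (hdS s) (mem_connectedComponentIn hs) hs' hρ hss
  obtain ⟨g₂, hg₂, he₂⟩ := exists_continuousOn_log_sub hΩ.isPlanarDomain
    isPreconnected_connectedComponentIn (hdS t) (mem_connectedComponentIn ht) ht' hρ htt
  set ρ' := (3 + 2 * A * N) * r with hρ'
  have hAN : 0 < A * N := by positivity
  have hρ'ρ : ρ' + r = ρ := by rw [hρ', hρr]; ring
  have h2ρ' : 2 * r ≤ ρ' := by rw [hρ']; nlinarith [mul_pos hAN hr]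
  have hsub₁ : Ω ∩ ball s ρ' ⊆ Ω ∩ ball s ρ :=
    inter_subset_inter_right _ (ball_subset_ball (by linarith))
  have hsub₂ : Ω ∩ ball s ρ' ⊆ Ω ∩ ball t ρ :=
    inter_subset_inter_right _ (ball_subset_ball' (by linarith))
  have hsub : Ω ∩ ball s (2 * r) ⊆ Ω ∩ ball s ρ' :=
    inter_subset_inter_right _ (ball_subset_ball h2ρ')
  have hL : ContinuousOn (fun z => g₁ z - g₂ z) (Ω ∩ ball s ρ') :=
    (hg₁.mono hsub₁).sub (hg₂.mono hsub₂)
  have hLe : ∀ z ∈ Ω ∩ ball s ρ', Complex.exp (g₁ z - g₂ z) = (z - s) / (z - t) := fun z hz => by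
    rw [Complex.exp_sub, he₁ z (hsub₁ hz), he₂ z (hsub₂ hz)]
  -- As t is not in the component of s, the part of the complement in the closed disk splits into
  -- compact pieces around s and around t.
  obtain ⟨P, Q, hP, hQ, hPQ, hd, hsP, hPt⟩ := exists_compact_partition
    (Y := Ωᶜ ∩ closedBall s r) (F := {t}) (H := {s})
    ((isCompact_closedBall s r).inter_left hΩ.isPlanarDomain.isOpen.isClosed_compl)
    isClosed_singleton isCompact_singleton
    (singleton_subset_iff.2 ⟨hs, mem_closedBall_self hr.le⟩) (by
      rintro x rfl
      rw [disjoint_singleton_right]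
      exact fun h => hts (connectedComponentIn_mono x inter_subset_left h))
  have htQ : t ∈ Q := by
    have : t ∈ P ∪ Q := by
      rw [hPQ]
      refine ⟨ht, ?_⟩
      rw [mem_closedBall, dist_comm]
      exact hst.le
    exact this.resolve_left (disjoint_singleton_right.1 hPt)
  suffices hG : ∃ G : ℂ → ℂ, (∀ z, r < dist z s ∨ z ∈ Ω ∩ ball s (2 * r) →
      Complex.exp (G z) = (z - s) / (z - t)) ∧
      ∀ z, r < dist z s ∨ z ∈ Ω ∩ ball s (2 * r) → ContinuousAt G z by
    obtain ⟨G, hGe, hGc⟩ := hG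
    refine not_exists_log_ratio_of_partition hr hP hQ hd (singleton_subset_iff.1 hsP) htQ
      (fun z hz => (hPQ ▸ Or.inl hz : z ∈ Ωᶜ ∩ closedBall s r).2)
      (fun z hz => (hPQ ▸ Or.inr hz : z ∈ Ωᶜ ∩ closedBall s r).2) (fun z h1 h2 => ?_) hGe hGc
    by_contra! hcon
    have : z ∈ P ∪ Q := by
      rw [hPQ]
      refine ⟨fun hz => hcon.2 ⟨hz, ?_⟩, hcon.1⟩
      rw [mem_ball]
      linarith [hcon.1]
    exact this.elim h1 h2
  refine exists_log_ratio_gluing (hΩ.isPlanarDomain.isOpen.inter isOpen_ball) hr hst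
    (hL.mono hsub) (fun z hz => hLe z (hsub hz)) ?_
  intro z hz w hw hzr hwr
  have hcs := connectedComponentIn_subset (Ω ∩ ball s (2 * r)) z
  have hlen := hN Ω hΩ (connectedComponentIn (Ω ∩ ball s (2 * r)) z)
    isPreconnected_connectedComponentIn (hcs.trans inter_subset_left) s (2 * r) (by positivity)
    (hcs.trans inter_subset_right) z (mem_connectedComponentIn hz) w hw
  obtain ⟨γ, hγ⟩ := hΩ.exists_curve z hz.1 w (hcs hw).1
  have hγl : curveLength γ 0 1 ≤ ENNReal.ofReal (A * (N * (2 * r))) := by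
    rw [ENNReal.ofReal_mul hA0.le]
    exact hγ.length_le.trans (by gcongr)
  have hγB : ∀ u ∈ Icc (0 : ℝ) 1, γ u ∈ ball s ρ' := by
    intro u hu
    have h1 : edist (γ 0) (γ u) ≤ ENNReal.ofReal (A * (N * (2 * r))) :=
      (edist_le_curveLength γ hu.1).trans ((curveLength_mono γ le_rfl hu.2).trans hγl)
    rw [hγ.isCurveIn.source, edist_dist, ENNReal.ofReal_le_ofReal_iff (by positivity)] at h1
    have h2 := hz.2
    rw [mem_ball] at h2 ⊢
    rw [hρ']
    linarith [dist_triangle (γ u) z s, dist_comm z (γ u)]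
  -- Along γ the principal logarithm of (z - t)/(z - s) is therefore defined, so its comparison with
  -- g₁ - g₂ is the same at z and at w. A path inside the component itself might pass too close to
  -- s.
  have hγs : ∀ u ∈ Icc (0 : ℝ) 1, dist s t < dist (γ u) s := fun u hu =>
    hγ.lt_dist_of_notMem hA hs hzr hwr hst'.le hu
  have hγne : ∀ u ∈ Icc (0 : ℝ) 1, γ u - s ≠ 0 := fun u hu h => by
    have := hγs u hu
    rw [sub_eq_zero.1 h, dist_self] at this
    exact absurd this (not_lt.2 dist_nonneg)
  have hγslit : ∀ u ∈ Icc (0 : ℝ) 1, (γ u - t) / (γ u - s) ∈ Complex.slitPlane := fun u hu => by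
    rw [show (γ u - t) / (γ u - s) = 1 - (t - s) / (γ u - s) by field_simp [hγne u hu]; ring]
    refine one_sub_div_mem_slitPlane ?_
    rw [← dist_eq_norm, ← dist_eq_norm, dist_comm t s]
    exact hγs u hu
  have hγc := hγ.isCurveIn.continuousOn
  have := eq_of_exp_eq_of_isPreconnected (isPreconnected_Icc (a := (0 : ℝ)) (b := 1))
    (f := fun u => g₁ (γ u) - g₂ (γ u)) (g := fun u => -Complex.log ((γ u - t) / (γ u - s)))
    (hL.comp hγc fun u hu => ⟨hγ.isCurveIn.mapsTo hu, hγB u hu⟩)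
    (ContinuousOn.neg (ContinuousOn.clog (ContinuousOn.div (by fun_prop) (by fun_prop) hγne) hγslit))
    (fun u hu => by
      rw [hLe _ ⟨hγ.isCurveIn.mapsTo hu, hγB u hu⟩, Complex.exp_neg,
        Complex.exp_log (Complex.slitPlane_ne_zero (hγslit u hu)), inv_div])
    (left_mem_Icc.2 zero_le_one) (right_mem_Icc.2 zero_le_one)
  simpa only [hγ.isCurveIn.source, hγ.isCurveIn.target, sub_neg_eq_add] using this

end

/-! ### Filling in the small complementary components -/

/-- `D` arises from `Ω` by filling in the complementary components of diameter at most `δ`. -/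
def IsFilling (δ : ℝ) (Ω D : Set ℂ) : Prop :=
  Dᶜ = ⋃₀ {S : Set ℂ | IsComplComponent Ω S ∧ ENNReal.ofReal δ < ediam S}

section

variable {Ω D : Set ℂ} {δ c : ℝ}

theorem isClosed_connectedComponentIn {X : Type*} [TopologicalSpace X] {F : Set X}
    (hF : IsClosed F) (x : X) : IsClosed (connectedComponentIn F x) := by
  by_cases hx : x ∈ F
  · refine isClosed_of_closure_subset ?_
    exact isPreconnected_connectedComponentIn.closure.subset_connectedComponentIn
      (subset_closure (mem_connectedComponentIn hx))
      (closure_minimal (connectedComponentIn_subset _ _) hF)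
  · rw [connectedComponentIn_eq_empty hx]
    exact isClosed_empty

theorem IsFilling.mem_compl_iff (h : IsFilling δ Ω D) {x : ℂ} :
    x ∈ Dᶜ ↔ x ∈ Ωᶜ ∧ ENNReal.ofReal δ < ediam (connectedComponentIn Ωᶜ x) := by
  rw [h, mem_sUnion]
  constructor
  · rintro ⟨_, ⟨⟨y, -, rfl⟩, hd⟩, hx⟩
    exact ⟨connectedComponentIn_subset _ _ hx, connectedComponentIn_eq hx ▸ hd⟩
  · rintro ⟨hx, hd⟩
    exact ⟨_, ⟨⟨x, hx, rfl⟩, hd⟩, mem_connectedComponentIn hx⟩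

theorem IsFilling.subset (h : IsFilling δ Ω D) : Ω ⊆ D := fun x hx => by
  by_contra hxD
  exact (h.mem_compl_iff.1 hxD).1 hx

theorem IsFilling.mem_of_mem_component (h : IsFilling δ Ω D) {x y : ℂ} (hx : x ∈ D)
    (hy : y ∈ connectedComponentIn Ωᶜ x) : y ∈ D := by
  by_contra hyD
  have := h.mem_compl_iff.1 hyD
  rw [← connectedComponentIn_eq hy] at this
  exact h.mem_compl_iff.2 ⟨connectedComponentIn_nonempty_iff.1 ⟨y, hy⟩, this.2⟩ hx

theorem IsFilling.dist_le (h : IsFilling δ Ω D) (hδ : 0 < δ) {x s₁ s₂ : ℂ} (hx : x ∈ D)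
    (h₁ : s₁ ∈ connectedComponentIn Ωᶜ x) (h₂ : s₂ ∈ connectedComponentIn Ωᶜ x) :
    dist s₁ s₂ ≤ δ := by
  have hle : ediam (connectedComponentIn Ωᶜ x) ≤ ENNReal.ofReal δ := not_lt.1 fun hlt =>
    h.mem_compl_iff.2 ⟨connectedComponentIn_nonempty_iff.1 ⟨s₁, h₁⟩, hlt⟩ hx
  have := (edist_le_ediam_of_mem h₁ h₂).trans hle
  rwa [edist_dist, ENNReal.ofReal_le_ofReal_iff hδ.le] at this

theorem IsFilling.exists_le_dist (h : IsFilling δ Ω D) {e : ℂ} (he : e ∈ Dᶜ) {ρ : ℝ}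
    (hρ : 2 * ρ ≤ δ) : ∃ t ∈ connectedComponentIn Ωᶜ e, ρ ≤ dist t e := by
  by_contra! hcon
  refine absurd (h.mem_compl_iff.1 he).2 (not_lt.2 (ediam_le fun x hx y hy => ?_))
  rw [edist_dist]
  refine ENNReal.ofReal_le_ofReal ?_
  linarith [hcon x hx, hcon y hy, dist_triangle_right x y e]

/-- By relative separation, all points of the complement of D close to a given limit point lie in a
single component, and that component is closed. -/
theorem IsFilling.isOpen (h : IsFilling δ Ω D) (hδ : 0 < δ) (hΩ : IsOpen Ω) (hc : 0 < c)
    (hsep : RelativelySeparated c Ω) : IsOpen D := by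
  rw [← isClosed_compl_iff]
  refine isClosed_of_closure_subset fun x hx => ?_
  have hr : 0 < c * δ / 8 := by positivity
  rw [Metric.mem_closure_iff] at hx
  obtain ⟨e, he, hxe⟩ := hx _ hr
  have hxmem : x ∈ connectedComponentIn Ωᶜ e := by
    have hcl : IsClosed (connectedComponentIn Ωᶜ e) :=
      isClosed_connectedComponentIn hΩ.isClosed_compl e
    rw [← hcl.closure_eq, Metric.mem_closure_iff]
    intro η hη
    obtain ⟨e', he', hxe'⟩ := hx _ (lt_min hη hr)
    refine ⟨e', ?_, hxe'.trans_le (min_le_left _ _)⟩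
    by_contra hne
    obtain ⟨t, ht, htd⟩ := h.exists_le_dist he (ρ := δ / 2) (by linarith)
    obtain ⟨t', ht', htd'⟩ := h.exists_le_dist he' (ρ := δ / 2) (by linarith)
    have := hsep e t e' t' (δ / 2) (h.mem_compl_iff.1 he').1 hne ht ht' (by positivity) htd htd'
    have h3 := hxe'.trans_le (min_le_right _ _)
    linarith [dist_triangle_left e e' x]
  refine h.mem_compl_iff.2 ⟨connectedComponentIn_subset _ _ hxmem, ?_⟩
  rw [← connectedComponentIn_eq hxmem]
  exact (h.mem_compl_iff.1 he).2

/-- A component missing the frontier of Ω would be clopen in the plane. -/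
theorem exists_mem_component_frontier (hΩ : IsPlanarDomain Ω) {x : ℂ} (hx : x ∈ Ωᶜ) :
    ∃ p ∈ connectedComponentIn Ωᶜ x, p ∈ frontier Ω := by
  by_contra! hcon
  have hcl : IsClosed (connectedComponentIn Ωᶜ x) :=
    isClosed_connectedComponentIn hΩ.isOpen.isClosed_compl x
  have hop : IsOpen (connectedComponentIn Ωᶜ x) := by
    refine Metric.isOpen_iff.2 fun y hy => ?_
    have hyc : y ∈ (closure Ω)ᶜ := fun hyc =>
      hcon y hy ⟨hyc, fun hyi => connectedComponentIn_subset _ _ hy (interior_subset hyi)⟩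
    obtain ⟨r, hr, hrc⟩ := Metric.isOpen_iff.1 isClosed_closure.isOpen_compl y hyc
    refine ⟨r, hr, ?_⟩
    rw [connectedComponentIn_eq hy]
    exact (convex_ball y r).isPreconnected.subset_connectedComponentIn (mem_ball_self hr)
      fun z hz hzΩ => hrc hz (subset_closure hzΩ)
  rcases isClopen_iff.1 ⟨hcl, hop⟩ with h | h
  · exact (h ▸ mem_connectedComponentIn hx : x ∈ (∅ : Set ℂ))
  · obtain ⟨z, hz⟩ := hΩ.isConnected.nonempty
    exact connectedComponentIn_subset Ωᶜ x (h ▸ mem_univ z) hz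

/-- Each filled component contains a frontier point p of Ω, and adjoining p keeps Ω connected, so
the component hangs on to Ω through p. -/
theorem IsFilling.isPlanarDomain (h : IsFilling δ Ω D) (hδ : 0 < δ) (hΩ : IsPlanarDomain Ω)
    (hc : 0 < c) (hsep : RelativelySeparated c Ω) : IsPlanarDomain D := by
  obtain ⟨x₀, hx₀⟩ := hΩ.isConnected.nonempty
  refine ⟨h.isOpen hδ hΩ.isOpen hc hsep, ⟨x₀, h.subset hx₀⟩,
    isPreconnected_of_forall x₀ fun y hy => ?_⟩
  by_cases hyΩ : y ∈ Ω
  · exact ⟨Ω, h.subset, hx₀, hyΩ, hΩ.isConnected.isPreconnected⟩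
  obtain ⟨p, hp, hpf⟩ := exists_mem_component_frontier hΩ hyΩ
  have hins : IsPreconnected (insert p Ω) :=
    hΩ.isConnected.isPreconnected.subset_closure (subset_insert _ _)
      (insert_subset hpf.1 subset_closure)
  refine ⟨insert p Ω ∪ connectedComponentIn Ωᶜ y, ?_, Or.inl (Or.inr hx₀),
    Or.inr (mem_connectedComponentIn hyΩ),
    hins.union p (mem_insert _ _) hp isPreconnected_connectedComponentIn⟩
  exact union_subset (insert_subset (h.mem_of_mem_component hy hp) h.subset)
    fun z hz => h.mem_of_mem_component hy hz

/-- A filled-in component lies at a distance from the complement of `D` that is at least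
comparable to its diameter. -/
theorem IsFilling.mul_dist_le (h : IsFilling δ Ω D) (hδ : 0 < δ)
    (hsep : RelativelySeparated c Ω) {x e s₁ s₂ : ℂ} (hx : x ∈ D)
    (he : e ∈ Dᶜ) (h₁ : s₁ ∈ connectedComponentIn Ωᶜ x) (h₂ : s₂ ∈ connectedComponentIn Ωᶜ x) :
    c / 2 * dist s₁ s₂ ≤ dist x e := by
  rcases eq_or_lt_of_le (dist_nonneg (x := s₁) (y := s₂)) with h0 | h0
  · rw [← h0, mul_zero]
    exact dist_nonneg
  have hne : e ∉ connectedComponentIn Ωᶜ x := fun hmem => he (h.mem_of_mem_component hx hmem)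
  have hd := h.dist_le hδ hx h₁ h₂
  -- Since |s₁ - s₂| ≤ δ, the unfilled component also reaches the scale |s₁ - s₂|/2, and separation
  -- applies to both at that scale.
  obtain ⟨t, ht, htd⟩ := h.exists_le_dist he (ρ := dist s₁ s₂ / 2) (by linarith)
  obtain ⟨s, hs, hsd⟩ : ∃ s ∈ connectedComponentIn Ωᶜ x, dist s₁ s₂ / 2 ≤ dist s x := by
    by_contra! hcon
    linarith [hcon s₁ h₁, hcon s₂ h₂, dist_triangle_right s₁ s₂ x]
  have := hsep x s e t _ (h.mem_compl_iff.1 he).1 hne hs ht (by positivity) hsd htd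
  linarith

/-- Inner distances in `Ω` are controlled by connections in the filled-in domain `D` whose size is
at least comparable to the distance from the complement of `D`. -/
theorem IsFilling.innerDist_le (h : IsFilling δ Ω D) (hδ : 0 < δ) (hΩ : IsPlanarDomain Ω)
    (hc : 0 < c) (hsep : RelativelySeparated c Ω) {N : ℝ} (hN : InnerDistBounded N Ω) {T : Set ℂ}
    (hT : IsCompact T) (hTc : IsPreconnected T) (hTD : T ⊆ D) {a b e : ℂ} (haT : a ∈ T)
    (hbT : b ∈ T) (ha : a ∈ Ω) (hb : b ∈ Ω) {L : ℝ} (hL : 0 < L) (hTL : T ⊆ ball a L)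
    (he : e ∈ Dᶜ) (hea : dist e a < L) :
    innerDist Ω a b ≤ ENNReal.ofReal (N * ((2 + 4 / c) * L)) := by
  -- A filled component meeting T extends at most (4/c)L from the meeting point, because e is within
  -- 2L of it; so it does not reach the sphere of radius R.
  set R := (2 + 4 / c) * L with hR
  have hLR : L < R := by rw [hR]; nlinarith [show 0 < 4 / c by positivity]
  have hR0 : 0 < R := hL.trans hLR
  have hΩc : IsClosed Ωᶜ := hΩ.isOpen.isClosed_compl
  obtain ⟨P, Q, hP, hQ, hPQ, hd, hHP, hPF⟩ := exists_compact_partition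
    (Y := Ωᶜ ∩ closedBall a R) (F := sphere a R) (H := T ∩ Ωᶜ)
    ((isCompact_closedBall a R).inter_left hΩc) isClosed_sphere (hT.inter_right hΩc)
    (fun z hz => ⟨hz.2, ball_subset_closedBall (ball_subset_ball hLR.le (hTL hz.1))⟩) (by
      intro x hx
      refine disjoint_left.2 fun s hs hsR => ?_
      have hs' := connectedComponentIn_mono x inter_subset_left hs
      have h1 := h.mul_dist_le hδ hsep (hTD hx.1) he hs' (mem_connectedComponentIn hx.2)
      have h2 := hTL hx.1
      rw [mem_ball] at h2
      rw [mem_sphere] at hsR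
      have h3 : c / 2 * dist s x ≤ 2 * L := by
        linarith [dist_triangle x a e, dist_comm a e]
      have h4 : dist s x ≤ 4 / c * L := by
        rw [div_mul_eq_mul_div, le_div_iff₀ hc]
        linarith
      have h5 := dist_triangle s x a
      rw [hR] at hsR
      linarith)
  set V := Ω ∩ ball a R with hV
  have hVo : IsOpen V := hΩ.isOpen.inter isOpen_ball
  have haV : a ∈ V := ⟨ha, mem_ball_self hR0⟩
  have hUV := connectedComponentIn_subset V a
  by_cases hbU : b ∈ connectedComponentIn V a
  · exact hN _ isPreconnected_connectedComponentIn (hUV.trans inter_subset_left) a R hR0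
      (hUV.trans inter_subset_right) a (mem_connectedComponentIn haV) b hbU
  exfalso
  -- P does not separate a from b because Ω avoids it, and Q together with the sphere does not
  -- because T avoids them. Hence b lies in the component of a in Ω ∩ B(a, R).
  refine not_separated_of_disjoint hP (hQ.union (isCompact_sphere a R))
    (disjoint_union_right.2 ⟨hd, hPF⟩) hΩ.isConnected.isPreconnected ?_ hTc ?_ ha hb haT hbT
    (isBounded_ball.subset (hUV.trans inter_subset_right)) ?_ (mem_connectedComponentIn haV) hbU
  · exact disjoint_left.2 fun z hz hzΩ => (hPQ ▸ Or.inl hz : z ∈ Ωᶜ ∩ closedBall a R).1 hzΩ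
  · refine disjoint_left.2 fun z hz hzT => hz.elim (fun hzQ => ?_) fun hzs => ?_
    · have hzY : z ∈ Ωᶜ ∩ closedBall a R := hPQ ▸ Or.inr hzQ
      exact disjoint_left.1 hd (hHP ⟨hzT, hzY.1⟩) hzQ
    · have := hTL hzT
      rw [mem_ball] at this
      rw [mem_sphere] at hzs
      linarith
  · intro z hz
    rw [hVo.connectedComponentIn.frontier_eq] at hz
    have hzR : z ∈ closedBall a R := closure_ball_subset_closedBall
      (closure_mono (hUV.trans inter_subset_right) hz.1)
    rw [← union_assoc, hPQ]
    rcases eq_or_lt_of_le (mem_closedBall.1 hzR) with hzs | hzb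
    · exact Or.inr hzs
    · refine Or.inl ⟨fun hzΩ => hz.2 ?_, hzR⟩
      have hzV : z ∈ V := ⟨hzΩ, hzb⟩
      obtain ⟨w, hw, hwU⟩ := mem_closure_iff.1 hz.1 _ hVo.connectedComponentIn
        (mem_connectedComponentIn hzV)
      rw [connectedComponentIn_eq hwU, ← connectedComponentIn_eq hw]
      exact mem_connectedComponentIn hzV

end

/-! ### Fillings are inner uniform -/

section

variable {A c δ : ℝ} {Ω D : Set ℂ}

theorem ofReal_le_mul_infEDist (hD : IsOpen D) {K ℓ : ℝ} (hK : 0 < K) {z : ℂ}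
    (h : ball z (ℓ / K) ⊆ D) : ENNReal.ofReal ℓ ≤ ENNReal.ofReal K * infEDist z (frontier D) := by
  rw [show ℓ = K * (ℓ / K) by field_simp, ENNReal.ofReal_mul hK.le]
  gcongr
  exact le_infEDist_frontier_of_ball hD h

/-- The component S of a has size comparable to u, the largest distance in S from a, and its
neighbourhood of width cu/4 stays at least cu/4 inside D. A covering by k disks bounds the inner
distance in this neighbourhood from a to a frontier point of Ω, next to which a' is chosen. -/
theorem exists_access_of_nontrivial {k : ℕ} (hk : ∀ (p : ℂ) (R : ℝ), 0 < R → ∃ t : Finset ℂ,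
      t.card ≤ k ∧ ∀ z ∈ closedBall p R, ∃ q ∈ t, dist z q < c / 8 * R)
    (hc : 0 < c) (hδ : 0 < δ) (hΩ : IsPlanarDomain Ω) (hsep : RelativelySeparated c Ω)
    (h : IsFilling δ Ω D) {a : ℂ} (ha : a ∈ D) (haΩ : a ∉ Ω)
    (hnt : ∃ s ∈ connectedComponentIn Ωᶜ a, s ≠ a) :
    ∃ a' ∈ Ω, ∃ (τ : ℝ → ℂ) (ℓ : ℝ), 0 ≤ ℓ ∧ IsCurveIn D a a' τ ∧
      curveLength τ 0 1 ≤ ENNReal.ofReal ℓ ∧ ∀ u ∈ Icc (0 : ℝ) 1, ball (τ u) (ℓ / (k + 2)) ⊆ D := by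
  set S := connectedComponentIn Ωᶜ a with hS
  have haS : a ∈ S := mem_connectedComponentIn haΩ
  have hScomp : IsCompact S := by
    refine Metric.isCompact_of_isClosed_isBounded
      (isClosed_connectedComponentIn hΩ.isOpen.isClosed_compl a) ?_
    exact isBounded_closedBall.subset fun s hs => mem_closedBall.2 (h.dist_le hδ ha hs haS)
  obtain ⟨s, hs, hsmax⟩ := hScomp.exists_isMaxOn ⟨a, haS⟩
    (f := fun z => dist z a) (by fun_prop)
  have hu : 0 < dist s a := by
    obtain ⟨s', hs', hne⟩ := hnt
    exact (dist_pos.2 hne).trans_le (hsmax hs')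
  set u := dist s a
  have hη : 0 < c / 4 * u := by positivity
  have hball : ∀ y ∈ S, ball y (2 * (c / 4 * u)) ⊆ D := fun y hy z hz => by
    by_contra hzD
    have hyS : S = connectedComponentIn Ωᶜ y := connectedComponentIn_eq hy
    have := h.mul_dist_le hδ hsep (h.mem_of_mem_component ha hy) hzD
      (hyS ▸ hs) (hyS ▸ haS)
    rw [mem_ball, dist_comm] at hz
    linarith
  set M := thickening (c / 4 * u) S with hM
  have hSM : S ⊆ M := self_subset_thickening hη S
  have hMball : ∀ z ∈ M, ball z (c / 4 * u) ⊆ D := fun z hz w hw => by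
    obtain ⟨y, hy, hzy⟩ := mem_thickening_iff.1 hz
    refine hball y hy ?_
    rw [mem_ball] at hw ⊢
    linarith [dist_triangle w z y]
  have hMD : M ⊆ D := fun z hz => hMball z hz (mem_ball_self hη)
  have hSball : ∀ y ∈ S, ball y (c / 4 * u) ⊆ M := fun y hy z hz =>
    mem_thickening_iff.2 ⟨y, hy, hz⟩
  obtain ⟨t, ht, hcov⟩ := hk a u hu
  obtain ⟨p, hp, hpf⟩ := exists_mem_component_frontier hΩ haΩ
  have hap : innerDist M a p ≤ ENNReal.ofReal (t.card * (c / 4 * u)) := by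
    refine innerDist_le_of_cover isOpen_thickening isPreconnected_connectedComponentIn hSM t
      (fun q => ball q (c / 8 * u)) (fun x hx => hcov x (hsmax hx))
      (fun q _ x hx y hy => ?_) hη.le haS hp
    have hyx : dist y x < c / 4 * u := by
      have h1 := hx.2
      have h2 := hy.2
      rw [mem_ball] at h1 h2
      linarith [dist_triangle_right y x q]
    refine (innerDist_le_edist_of_ball (hSball x hx.1) hyx).trans ?_
    rw [edist_dist, dist_comm]
    exact ENNReal.ofReal_le_ofReal hyx.le
  obtain ⟨a', ha', hpa'⟩ := Metric.mem_closure_iff.1 hpf.1 _ hη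
  have hpa : innerDist M p a' ≤ ENNReal.ofReal (c / 4 * u) := by
    refine (innerDist_le_edist_of_ball (hSball p hp) (by rwa [dist_comm])).trans ?_
    rw [edist_dist]
    exact ENNReal.ofReal_le_ofReal hpa'.le
  -- k steps for the covering and one from p to a'; the last unit makes the inequality strict.
  have hlt : innerDist M a a' < ENNReal.ofReal ((k + 2) * (c / 4 * u)) := by
    refine ((innerDist_triangle M a p a').trans (add_le_add hap hpa)).trans_lt ?_
    rw [← ENNReal.ofReal_add (by positivity) hη.le, ENNReal.ofReal_lt_ofReal_iff (by positivity)]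
    have : (t.card : ℝ) ≤ k := by exact_mod_cast ht
    nlinarith
  obtain ⟨τ, hτ, hτl⟩ := exists_curve_of_innerDist_lt hlt
  refine ⟨a', ha', τ, (k + 2) * (c / 4 * u), by positivity, hτ.mono hMD, hτl.le, fun v hv => ?_⟩
  rw [mul_div_cancel_left₀ _ (by positivity : (k + 2 : ℝ) ≠ 0)]
  exact hMball _ (hτ.mapsTo hv)

/-- Every point of the filled-in domain can be joined to a point of `Ω` along a curve whose
length is controlled by its distance to the complement of `D`. -/
theorem exists_access (hc : 0 < c) : ∃ K : ℝ, 1 ≤ K ∧ ∀ (Ω D : Set ℂ) (δ : ℝ), 0 < δ →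
    IsPlanarDomain Ω → RelativelySeparated c Ω → IsFilling δ Ω D → ∀ a ∈ D,
    ∃ a' ∈ Ω, ∃ (τ : ℝ → ℂ) (ℓ : ℝ), 0 ≤ ℓ ∧ IsCurveIn D a a' τ ∧
      curveLength τ 0 1 ≤ ENNReal.ofReal ℓ ∧ ∀ u ∈ Icc (0 : ℝ) 1, ball (τ u) (ℓ / K) ⊆ D := by
  obtain ⟨k, hk⟩ := exists_cover_card (c := c / 8) (by positivity)
  have hk1 : (1 : ℝ) ≤ k + 2 := by linarith [(Nat.cast_nonneg k : (0 : ℝ) ≤ k)]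
  refine ⟨k + 2, hk1, fun Ω D δ hδ hΩ hsep h a ha => ?_⟩
  by_cases haΩ : a ∈ Ω
  · exact ⟨a, haΩ, fun _ => a, 0, le_rfl, isCurveIn_const ha, by rw [curveLength_const]; simp,
      by simp⟩
  by_cases hnt : ∃ s ∈ connectedComponentIn Ωᶜ a, s ≠ a
  · exact exists_access_of_nontrivial hk hc hδ hΩ hsep h ha haΩ hnt
  push Not at hnt
  -- The component is the single point a, hence a is a frontier point of Ω; it has no size of its
  -- own, and a disk around a in D supplies the scale.
  obtain ⟨p, hp, hpf⟩ := exists_mem_component_frontier hΩ haΩ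
  rw [hnt p hp] at hpf
  obtain ⟨r, hr, hrD⟩ := Metric.isOpen_iff.1 (h.isOpen hδ hΩ.isOpen hc hsep) a ha
  obtain ⟨a', ha', haa'⟩ := Metric.mem_closure_iff.1 hpf.1 _ (half_pos hr)
  have hseg : segment ℝ a a' ⊆ ball a (r / 2) :=
    (convex_ball a (r / 2)).segment_subset (mem_ball_self (half_pos hr))
      (by rwa [mem_ball, dist_comm])
  refine ⟨a', ha', seg a a', r / 2, (half_pos hr).le,
    isCurveIn_seg (hseg.trans ((ball_subset_ball (by linarith)).trans hrD)),
    (curveLength_seg_le 0 1 le_rfl le_rfl).trans ?_, fun u hu z hz => hrD ?_⟩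
  · rw [edist_dist]
    exact ENNReal.ofReal_le_ofReal haa'.le
  · have h1 := (isCurveIn_seg hseg).mapsTo hu
    have h2 : r / 2 / (k + 2) ≤ r / 2 := div_le_self (half_pos hr).le hk1
    rw [mem_ball] at h1 hz ⊢
    linarith [dist_triangle z (seg a a' u) a]

/-- Settles the case of endpoints close together compared with the distance to the complement: all
of the segment has clearance l, which is at least its length. -/
theorem isInnerUniformCurve_seg (hD : IsOpen D) {C l : ℝ} (hC : 1 ≤ C) {a b p : ℂ}
    (hab : dist a b ≤ l) (hl : 0 < l) (hp : ball p (2 * l) ⊆ D)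
    (hseg : ∀ z ∈ segment ℝ a b, dist z p ≤ l) :
    IsInnerUniformCurve C D a b (seg a b) := by
  have hC' : (1 : ℝ≥0∞) ≤ ENNReal.ofReal C := by simpa using hC
  have hsub : ∀ z ∈ segment ℝ a b, ball z l ⊆ D := fun z hz w hw => hp <| by
    rw [mem_ball] at hw ⊢
    linarith [hseg z hz, dist_triangle w z p]
  refine ⟨isCurveIn_seg fun z hz => hsub z hz (mem_ball_self hl), ?_, fun t ht => ?_⟩
  · calc curveLength (seg a b) 0 1 ≤ edist a b := curveLength_seg_le 0 1 le_rfl le_rfl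
      _ ≤ 1 * innerDist D a b := by rw [one_mul]; exact edist_le_innerDist
      _ ≤ _ := by gcongr
  · calc min (curveLength (seg a b) 0 t) (curveLength (seg a b) t 1)
        ≤ edist a b := (min_le_left _ _).trans (curveLength_seg_le 0 t le_rfl ht.2)
      _ ≤ ENNReal.ofReal l := by rw [edist_dist]; exact ENNReal.ofReal_le_ofReal hab
      _ ≤ 1 * infEDist (seg a b t) (frontier D) := by
          rw [one_mul]
          exact le_infEDist_frontier_of_ball hD
            (hsub _ ((isCurveIn_seg (Subset.refl (segment ℝ a b))).mapsTo ht))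
      _ ≤ _ := by gcongr

/-- Absorbing the length of a short initial curve. -/
theorem add_curveLength_le (hA : 0 ≤ A) {K ℓ : ℝ} (hK : 0 ≤ K) {E x y : ℝ≥0∞} {p q : ℂ}
    {F : Set ℂ} (hp : ENNReal.ofReal ℓ ≤ ENNReal.ofReal K * infEDist p F)
    (hx : x ≤ ENNReal.ofReal ℓ) (hy : y ≤ ENNReal.ofReal A * E) (hE : E = infEDist q F)
    (hpq : edist p q ≤ y) : x + y ≤ ENNReal.ofReal (K * (1 + A) + A) * E := by
  have h1 : infEDist p F ≤ E + ENNReal.ofReal A * E := by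
    rw [hE] at hy ⊢
    exact infEDist_le_infEDist_add_edist.trans (by gcongr; exact hpq.trans hy)
  calc x + y ≤ ENNReal.ofReal K * (E + ENNReal.ofReal A * E) + ENNReal.ofReal A * E := by
        refine add_le_add (hx.trans (hp.trans ?_)) hy
        gcongr
    _ = ENNReal.ofReal (K * (1 + A) + A) * E := by
        rw [ENNReal.ofReal_add (by positivity) hA, ENNReal.ofReal_mul hK,
          ENNReal.ofReal_add zero_le_one hA, ENNReal.ofReal_one]
        ring

/-- The cigar condition for the concatenation of an inner uniform curve of `Ω ⊆ D` with
two curves that stay away from the boundary of `D`. -/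
theorem cigar_concat (hA : 1 ≤ A) (hD : IsOpen D) (hΩD : Ω ⊆ D) {K : ℝ} (hK : 1 ≤ K)
    {a a' b b' : ℂ} {τ₁ τ₂ γ : ℝ → ℂ} {ℓ₁ ℓ₂ : ℝ} (h₁ : IsCurveIn D a a' τ₁)
    (h₂ : IsCurveIn D b b' τ₂) (hl₁ : curveLength τ₁ 0 1 ≤ ENNReal.ofReal ℓ₁)
    (hl₂ : curveLength τ₂ 0 1 ≤ ENNReal.ofReal ℓ₂)
    (hb₁ : ∀ u ∈ Icc (0 : ℝ) 1, ball (τ₁ u) (ℓ₁ / K) ⊆ D)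
    (hb₂ : ∀ u ∈ Icc (0 : ℝ) 1, ball (τ₂ u) (ℓ₂ / K) ⊆ D)
    (hγ : IsInnerUniformCurve A Ω a' b' γ) {t : ℝ} (ht : t ∈ Icc (0 : ℝ) 1) :
    min (curveLength (concat τ₁ (concat γ (rev τ₂))) 0 t)
      (curveLength (concat τ₁ (concat γ (rev τ₂))) t 1) ≤
      ENNReal.ofReal (K * (1 + A) + A) *
        infEDist (concat τ₁ (concat γ (rev τ₂)) t) (frontier D) := by
  have hA0 : 0 ≤ A := by linarith
  have hK0 : 0 < K := by linarith
  have hKC : K ≤ K * (1 + A) + A := by nlinarith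
  have hγr : γ 1 = rev τ₂ 0 := by rw [hγ.isCurveIn.target, h₂.rev.source]
  have hτγ : τ₁ 1 = concat γ (rev τ₂) 0 := by
    rw [h₁.target, (hγ.isCurveIn.mono hΩD).concat h₂.rev |>.source]
  have hrevlen : curveLength (rev τ₂) 0 1 = curveLength τ₂ 0 1 := by
    rw [curveLength_rev]
    simp
  have hE₁ : ENNReal.ofReal ℓ₁ ≤ ENNReal.ofReal K * infEDist a' (frontier D) := by
    have := hb₁ 1 (right_mem_Icc.2 zero_le_one)
    rw [h₁.target] at this
    exact ofReal_le_mul_infEDist hD hK0 this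
  have hE₂ : ENNReal.ofReal ℓ₂ ≤ ENNReal.ofReal K * infEDist b' (frontier D) := by
    have := hb₂ 1 (right_mem_Icc.2 zero_le_one)
    rw [h₂.target] at this
    exact ofReal_le_mul_infEDist hD hK0 this
  by_cases ht2 : t ≤ 1 / 2
  · have hu : 2 * t ∈ Icc (0 : ℝ) 1 := ⟨by linarith [ht.1], by linarith⟩
    refine (min_le_left _ _).trans ?_
    rw [curveLength_concat_left _ _ ht2, concat, if_pos ht2]
    calc curveLength τ₁ (2 * 0) (2 * t) ≤ curveLength τ₁ 0 1 :=
          curveLength_mono _ (by simp) hu.2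
      _ ≤ ENNReal.ofReal K * infEDist (τ₁ (2 * t)) (frontier D) :=
          hl₁.trans (ofReal_le_mul_infEDist hD hK0 (hb₁ _ hu))
      _ ≤ _ := by gcongr
  push Not at ht2
  have hz : concat τ₁ (concat γ (rev τ₂)) t = concat γ (rev τ₂) (2 * t - 1) := by
    rw [concat, if_neg (not_le.2 ht2)]
  rw [hz, curveLength_concat_zero hτγ ht2.le, curveLength_concat_right hτγ ht2.le]
  norm_num only
  have hs : 2 * t - 1 ∈ Icc (0 : ℝ) 1 := ⟨by linarith, by linarith [ht.2]⟩
  generalize 2 * t - 1 = s at hs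
  by_cases hs2 : s ≤ 1 / 2
  · have hv : 2 * s ∈ Icc (0 : ℝ) 1 := ⟨by linarith [hs.1], by linarith⟩
    have hzs : concat γ (rev τ₂) s = γ (2 * s) := by rw [concat, if_pos hs2]
    rw [hzs, curveLength_concat_left _ _ hs2, curveLength_concat_one hγr hs2, hrevlen, mul_zero]
    have hcig := (hγ.cigar _ hv).trans (mul_le_mul_right
      (infEDist_frontier_mono hD hΩD (hγ.isCurveIn.mapsTo hv)) (ENNReal.ofReal A))
    -- The access curve is added on the side of the shorter subarc of γ. Its length is bounded by K
    -- times the boundary distance at its end, which exceeds that at the current point by at most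
    -- the length of the subarc.
    rcases min_le_iff.1 hcig with h | h
    · refine (min_le_left _ _).trans (add_curveLength_le hA0 hK0.le hE₁ hl₁ h rfl ?_)
      rw [← hγ.isCurveIn.source]
      exact edist_le_curveLength γ hv.1
    · refine (min_le_right _ _).trans ?_
      rw [add_comm]
      refine add_curveLength_le hA0 hK0.le hE₂ hl₂ h rfl ?_
      rw [← hγ.isCurveIn.target, edist_comm]
      exact edist_le_curveLength γ hv.2
  · push Not at hs2
    have hu : 1 - (2 * s - 1) ∈ Icc (0 : ℝ) 1 := ⟨by linarith [hs.2], by linarith⟩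
    have hzs : concat γ (rev τ₂) s = τ₂ (1 - (2 * s - 1)) := by
      rw [concat, if_neg (not_le.2 hs2), rev]
    refine (min_le_right _ _).trans ?_
    rw [hzs, curveLength_concat_right hγr hs2.le, curveLength_rev]
    calc curveLength τ₂ (1 - (2 * 1 - 1)) (1 - (2 * s - 1)) ≤ curveLength τ₂ 0 1 :=
          curveLength_mono _ (by norm_num) hu.2
      _ ≤ ENNReal.ofReal K * infEDist (τ₂ (1 - (2 * s - 1))) (frontier D) :=
          hl₂.trans (ofReal_le_mul_infEDist hD hK0 (hb₂ _ hu))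
      _ ≤ _ := by gcongr

/-- Filling in the small complementary components of an inner uniform domain gives an inner
uniform domain. -/
theorem exists_isInnerUniformDomain_filling (hA : 1 ≤ A) :
    ∃ C : ℝ, 1 ≤ C ∧ ∀ (Ω D : Set ℂ) (δ : ℝ), 0 < δ → IsInnerUniformDomain A Ω →
      IsFilling δ Ω D → IsInnerUniformDomain C D := by
  obtain ⟨c, hc, hsep⟩ := exists_relativelySeparated hA
  obtain ⟨N, hN1, hN⟩ := exists_innerDistBounded hA
  obtain ⟨K, hK1, hK⟩ := exists_access hc
  have hA0 : 0 < A := by linarith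
  have hK0 : 0 < K := by linarith
  -- The connection in D from a' to b' has length at most (4K + 2)l, and e is within (2K + 2)l of
  -- a'; the radius (4K + 5)l strictly exceeds both.
  set M := N * ((2 + 4 / c) * (4 * K + 5)) with hM
  have hM0 : 0 < M := by positivity
  set C := 4 * K + A * M + (K * (1 + A) + A) with hC
  have hC1 : 1 ≤ C := by rw [hC]; nlinarith [mul_pos hA0 hM0, mul_pos hK0 hA0]
  have hC2 : 4 * K + A * M ≤ C := by rw [hC]; nlinarith [mul_pos hK0 hA0]
  have hC3 : K * (1 + A) + A ≤ C := by rw [hC]; nlinarith [mul_pos hA0 hM0]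
  refine ⟨C, hC1, fun Ω D δ hδ hΩ h => ?_⟩
  have hsepΩ := hsep Ω hΩ
  have hD := h.isPlanarDomain hδ hΩ.isPlanarDomain hc hsepΩ
  refine ⟨hD, fun a ha b hb => ?_⟩
  rcases eq_or_ne a b with rfl | hab
  · exact ⟨fun _ => a, isCurveIn_const ha, by rw [curveLength_const]; exact zero_le,
      fun t _ => by rw [curveLength_const, min_eq_left zero_le]; exact zero_le⟩
  have hfin := (innerDist_lt_top hD.isOpen hD.isConnected.isPreconnected Subset.rfl ha hb).ne
  set l := (innerDist D a b).toReal with hl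
  have hlI : innerDist D a b = ENNReal.ofReal l := (ENNReal.ofReal_toReal hfin).symm
  have habl : dist a b ≤ l := by
    have := edist_le_innerDist (Ω := D) (a := a) (b := b)
    rwa [hlI, edist_dist, ENNReal.ofReal_le_ofReal_iff ENNReal.toReal_nonneg] at this
  have hl0 : 0 < l := (dist_pos.2 hab).trans_le habl
  by_cases hba : ball a (2 * l) ⊆ D
  · exact ⟨_, isInnerUniformCurve_seg hD.isOpen hC1 habl hl0 hba fun z hz => by
      linarith [dist_add_dist_of_mem_segment hz, dist_comm a z, dist_nonneg (x := z) (y := b)]⟩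
  by_cases hbb : ball b (2 * l) ⊆ D
  · exact ⟨_, isInnerUniformCurve_seg hD.isOpen hC1 habl hl0 hbb fun z hz => by
      linarith [dist_add_dist_of_mem_segment hz, dist_nonneg (x := a) (y := z)]⟩
  obtain ⟨e, hea, he⟩ := not_subset.1 hba
  obtain ⟨e', heb, he'⟩ := not_subset.1 hbb
  rw [mem_ball] at hea heb
  obtain ⟨a', ha', τ₁, ℓ₁, hℓ₁, hτ₁, hτl₁, hτb₁⟩ := hK Ω D δ hδ hΩ.isPlanarDomain hsepΩ h a ha
  obtain ⟨b', hb', τ₂, ℓ₂, hℓ₂, hτ₂, hτl₂, hτb₂⟩ := hK Ω D δ hδ hΩ.isPlanarDomain hsepΩ h b hb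
  -- Now both endpoints are within 2l of the complement of D, so the access curves cannot be long
  -- compared with l.
  have hbound : ∀ {x y : ℂ} {τ : ℝ → ℂ} {ℓ : ℝ}, τ 0 = x → dist y x < 2 * l → y ∉ D →
      (∀ u ∈ Icc (0 : ℝ) 1, ball (τ u) (ℓ / K) ⊆ D) → ℓ ≤ 2 * K * l := by
    intro x y τ ℓ hx hyx hy hb
    have h0 := hb 0 (left_mem_Icc.2 zero_le_one)
    rw [hx] at h0
    have h1 : ℓ / K ≤ dist y x := not_lt.1 fun hlt => hy (h0 hlt)
    have h2 := h1.trans hyx.le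
    rw [div_le_iff₀ hK0] at h2
    linarith
  have hℓ₁l := hbound hτ₁.source hea he hτb₁
  have hℓ₂l := hbound hτ₂.source heb he' hτb₂
  obtain ⟨σ, hσ, hσl⟩ := exists_curve_of_innerDist_lt
    (show innerDist D a b < ENNReal.ofReal (2 * l) by
      rw [hlI, ENNReal.ofReal_lt_ofReal_iff (by positivity)]
      linarith)
  -- This curve only witnesses that a' and b' are connected in D at scale l; the final curve uses an
  -- inner uniform curve of Ω instead of σ.
  have hΓ := hτ₁.rev.concat (hσ.concat hτ₂)
  set Γ := concat (rev τ₁) (concat σ τ₂)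
  have hΓl : curveLength Γ 0 1 ≤ ENNReal.ofReal ((4 * K + 2) * l) := by
    rw [curveLength_concat (by rw [hτ₁.rev.target, (hσ.concat hτ₂).source]),
      curveLength_concat (by rw [hσ.target, hτ₂.source]), curveLength_rev, sub_self, sub_zero]
    refine (add_le_add hτl₁ (add_le_add hσl.le hτl₂)).trans ?_
    rw [← ENNReal.ofReal_add (by positivity) hℓ₂, ← ENNReal.ofReal_add hℓ₁ (by positivity)]
    exact ENNReal.ofReal_le_ofReal (by linarith)
  have haa' : dist a a' ≤ 2 * K * l := by
    have := (edist_le_curveLength τ₁ zero_le_one).trans hτl₁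
    rw [hτ₁.source, hτ₁.target, edist_dist, ENNReal.ofReal_le_ofReal_iff hℓ₁] at this
    linarith
  have hin : innerDist Ω a' b' ≤ ENNReal.ofReal (M * l) := by
    have := h.innerDist_le hδ hΩ.isPlanarDomain hc hsepΩ (hN Ω hΩ) (T := Γ '' Icc 0 1)
      (isCompact_Icc.image_of_continuousOn hΓ.continuousOn)
      (isPreconnected_Icc.image _ hΓ.continuousOn) hΓ.mapsTo.image_subset
      ⟨0, left_mem_Icc.2 zero_le_one, hΓ.source⟩ ⟨1, right_mem_Icc.2 zero_le_one, hΓ.target⟩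
      ha' hb' (L := (4 * K + 5) * l) (by positivity) (by
        rintro _ ⟨u, hu, rfl⟩
        have h1 := (edist_le_curveLength Γ hu.1).trans
          ((curveLength_mono Γ le_rfl hu.2).trans hΓl)
        rw [hΓ.source, edist_dist, ENNReal.ofReal_le_ofReal_iff (by positivity)] at h1
        rw [mem_ball, dist_comm]
        linarith) he (by
        have h2 : 0 < K * l := by positivity
        linarith [dist_triangle e a a'])
    refine this.trans_eq (congrArg _ ?_)
    rw [hM]
    ring
  obtain ⟨γ, hγ⟩ := hΩ.exists_curve a' ha' b' hb'
  have hγD := hγ.isCurveIn.mono h.subset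
  refine ⟨concat τ₁ (concat γ (rev τ₂)), hτ₁.concat (hγD.concat hτ₂.rev), ?_, fun t ht => ?_⟩
  · rw [curveLength_concat (by rw [hτ₁.target, (hγD.concat hτ₂.rev).source]),
      curveLength_concat (by rw [hγD.target, hτ₂.rev.source]), curveLength_rev, sub_self, sub_zero,
      hlI, ← ENNReal.ofReal_mul (by linarith)]
    have h1 : curveLength γ 0 1 ≤ ENNReal.ofReal (A * (M * l)) := by
      rw [ENNReal.ofReal_mul hA0.le]
      exact hγ.length_le.trans (by gcongr)
    refine (add_le_add hτl₁ (add_le_add h1 hτl₂)).trans ?_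
    rw [← ENNReal.ofReal_add (by positivity) hℓ₂, ← ENNReal.ofReal_add hℓ₁ (by positivity)]
    refine ENNReal.ofReal_le_ofReal ?_
    have := mul_le_mul_of_nonneg_right hC2 hl0.le
    linarith
  · refine (cigar_concat hA hD.isOpen h.subset hK1 hτ₁ hτ₂ hτl₁ hτl₂ hτb₁ hτb₂ hγ ht).trans ?_
    gcongr

/-! ### Exhaustion by finitely connected domains -/

/-- Components are kept or filled as a whole, so one that is kept stays connected in the smaller
complement. -/
theorem IsFilling.component_eq (h : IsFilling δ Ω D) {x : ℂ} (hx : x ∈ Dᶜ) :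
    connectedComponentIn Dᶜ x = connectedComponentIn Ωᶜ x := by
  refine Subset.antisymm (connectedComponentIn_mono x (compl_subset_compl.2 h.subset)) ?_
  refine isPreconnected_connectedComponentIn.subset_connectedComponentIn
    (mem_connectedComponentIn (h.mem_compl_iff.1 hx).1) fun y hy => ?_
  have h1 := h.mem_compl_iff.1 hx
  rw [connectedComponentIn_eq hy] at h1
  exact h.mem_compl_iff.2 ⟨connectedComponentIn_subset _ _ hy, h1.2⟩

theorem isCompact_frontier (h : Bornology.IsBounded Ω ∨ ContainsNhdInfty Ω) :
    IsCompact (frontier Ω) := by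
  rcases h with h | ⟨p, R, hR⟩
  · exact h.isCompact_closure.of_isClosed_subset isClosed_frontier frontier_subset_closure
  · refine (isCompact_closedBall p R).of_isClosed_subset isClosed_frontier ?_
    rw [← frontier_compl]
    refine frontier_subset_closure.trans (closure_minimal ?_ isClosed_closedBall)
    rwa [compl_subset_comm]

/-- Each remaining component contains a point of the compact frontier of Ω. Cover the frontier by
finitely many disks of radius cδ/4; by separation at scale δ/2, points from two distinct remaining
components never share a disk. -/
theorem IsFilling.isFinitelyConnected (h : IsFilling δ Ω D) (hδ : 0 < δ) (hΩ : IsPlanarDomain Ω)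
    (hc : 0 < c) (hsep : RelativelySeparated c Ω)
    (hΩb : Bornology.IsBounded Ω ∨ ContainsNhdInfty Ω) : IsFinitelyConnected D := by
  obtain ⟨t, -, ht, hcov⟩ := (isCompact_frontier hΩb).finite_cover_balls
    (show 0 < c * δ / 4 by positivity)
  have hpt : ∀ S, IsComplComponent D S → ∃ q ∈ t, ∃ p ∈ Dᶜ, S = connectedComponentIn Ωᶜ p ∧
      dist p q < c * δ / 4 := by
    rintro _ ⟨x, hx, rfl⟩
    obtain ⟨p, hp, hpf⟩ := exists_mem_component_frontier hΩ (h.mem_compl_iff.1 hx).1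
    obtain ⟨q, hq, hpq⟩ := mem_iUnion₂.1 (hcov hpf)
    refine ⟨q, hq, p, ?_, (h.component_eq hx).trans (connectedComponentIn_eq hp), hpq⟩
    rw [← h.component_eq hx] at hp
    exact connectedComponentIn_subset _ _ hp
  choose! q hq p hp hSp hpq using hpt
  refine Finite.of_finite_image (ht.subset (image_subset_iff.2 hq)) fun S hS S' hS' hqq => ?_
  by_contra hne
  have hnot : p S' ∉ connectedComponentIn Ωᶜ (p S) := fun hmem =>
    hne (by rw [hSp S hS, hSp S' hS', connectedComponentIn_eq hmem])
  obtain ⟨u, hu, hud⟩ := h.exists_le_dist (hp S hS) (ρ := δ / 2) (by linarith)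
  obtain ⟨v, hv, hvd⟩ := h.exists_le_dist (hp S' hS') (ρ := δ / 2) (by linarith)
  have h1 := hsep _ u _ v (δ / 2) (h.mem_compl_iff.1 (hp S' hS')).1 hnot hu hv (by positivity)
    hud hvd
  have h2 := hpq S hS
  have h3 := hpq S' hS'
  rw [hqq] at h2
  linarith [dist_triangle_right (p S) (p S') (q S')]

end

end InnerUniform

/-! ### Proof of the theorem -/

theorem theorem2p9 :
    ∀ A : ℝ, 1 ≤ A → ∃ C : ℝ, 1 ≤ C ∧
      (∀ Ω : Set ℂ, InnerUniform.IsInnerUniformDomain A Ω →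
        ∀ δ : ℝ, 0 < δ → ∀ D : Set ℂ,
          Dᶜ = ⋃₀ {S : Set ℂ | InnerUniform.IsComplComponent Ω S ∧
            ENNReal.ofReal δ < Metric.ediam S} →
          InnerUniform.IsInnerUniformDomain C D) ∧
      (∀ Ω : Set ℂ, InnerUniform.IsInnerUniformDomain A Ω →
        (Bornology.IsBounded Ω ∨ InnerUniform.ContainsNhdInfty Ω) →
        ∃ W : ℕ → Set ℂ,
          (∀ n, InnerUniform.IsFinitelyConnected (W n) ∧
            InnerUniform.IsInnerUniformDomain C (W n)) ∧
          (∀ n, Ω ⊆ W (n + 1) ∧ W (n + 1) ⊆ W n) ∧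
          (∀ S : Set ℂ, InnerUniform.IsComplComponent Ω S → S.Nontrivial →
            ∀ᶠ n in Filter.atTop, InnerUniform.IsComplComponent (W n) S) ∧
          IsTotallyDisconnected ((⋂ n, W n) \ Ω)) := by
  intro A hA
  obtain ⟨C, hC1, hC⟩ := InnerUniform.exists_isInnerUniformDomain_filling hA
  obtain ⟨c, hc, hsep⟩ := InnerUniform.exists_relativelySeparated hA
  refine ⟨C, hC1, fun Ω hΩ δ hδ D hD => hC Ω D δ hδ hΩ hD, fun Ω hΩ hΩb => ?_⟩
  let W : ℕ → Set ℂ := fun n => (⋃₀ {S : Set ℂ | InnerUniform.IsComplComponent Ω S ∧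
    ENNReal.ofReal (1 / ((n : ℝ) + 1)) < Metric.ediam S})ᶜ
  have hW : ∀ n : ℕ, InnerUniform.IsFilling (1 / ((n : ℝ) + 1)) Ω (W n) := fun n => compl_compl _
  have hpos : ∀ n : ℕ, 0 < 1 / ((n : ℝ) + 1) := fun n => Nat.one_div_pos_of_nat
  have hlarge : ∀ x y : ℂ, x ∉ Ω → y ∈ connectedComponentIn Ωᶜ x → x ≠ y →
      ∀ᶠ n in Filter.atTop, x ∈ (W n)ᶜ := by
    intro x y hx hy hxy
    have hlim := tendsto_one_div_add_atTop_nhds_zero_nat (𝕜 := ℝ)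
    filter_upwards [hlim.eventually (gt_mem_nhds (dist_pos.2 hxy))] with n hn
    refine (hW n).mem_compl_iff.2 ⟨hx, ?_⟩
    refine lt_of_lt_of_le ?_ (Metric.edist_le_ediam_of_mem (mem_connectedComponentIn hx) hy)
    rw [edist_dist]
    exact (ENNReal.ofReal_lt_ofReal_iff (dist_pos.2 hxy)).2 hn
  refine ⟨W, fun n => ⟨(hW n).isFinitelyConnected (hpos n) hΩ.isPlanarDomain hc (hsep Ω hΩ) hΩb,
    hC Ω (W n) _ (hpos n) hΩ (hW n)⟩, fun n => ⟨(hW (n + 1)).subset, ?_⟩, ?_, ?_⟩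
  · rw [← compl_subset_compl]
    intro x hx
    have h1 := (hW n).mem_compl_iff.1 hx
    refine (hW (n + 1)).mem_compl_iff.2 ⟨h1.1, lt_of_le_of_lt (ENNReal.ofReal_le_ofReal ?_) h1.2⟩
    exact Nat.one_div_le_one_div (Nat.le_succ n)
  · rintro S ⟨x, hx, rfl⟩ hnt
    obtain ⟨y, hy, hyx⟩ := hnt.exists_ne x
    filter_upwards [hlarge x y hx hy hyx.symm] with n hn
    exact ⟨x, hn, ((hW n).component_eq hn).symm⟩
  · intro T hT hTc x hx y hy
    by_contra hxy
    -- A connected subset lies in one component of the complement of Ω; with two distinct points,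
    -- that component has positive diameter and is not filled for large n.
    have hsub := hTc.subset_connectedComponentIn hx fun z hz => (hT hz).2
    obtain ⟨n, hn⟩ := (hlarge x y (hT hx).2 (hsub hy) hxy).exists
    exact hn (mem_iInter.1 (hT hx).1 n)
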